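/- A nonassociative relation algebra ($\mathsf{NA}$) is a Boolean algebra with a binary operation $;$ (relative product), a unary operation $\breve{\ }$ (converse) and a constant $1'$ satisfying all of Tarski's axioms for relation algebras except possibly associativity of $;$; put $0'=\overline{1'}$, and call atoms below $0'$ diversity atoms. Such an algebra is symmetric if $\breve x=x$ for all $x$, and integral if $1'$ is an atom. It is representable if it is isomorphic to an algebra of binary relations on a set, whose largest relation is an equivalence relation $W$, under union, complement relative to $W$, relational composition, inversion and the identity relation; it is completely representable if the isomorphism can be chosen to send every existing join to the union. A completion of $\mathbf B$ is a complete algebra having $\mathbf B$ as a subalgebra such that below every nonzero element there is a nonzero element of $\mathbf B$. Let $\mathbf A$ be a finite symmetric integral relation algebra with a subalgebra $\mathbf E$. (1) $\mathbf A$ is a special extension of $\mathbf E$ if for all diversity atoms $a,b,c$ of $\mathbf E$: (i) if not $a=b=c$ and $a;b\ge c$, then $x;y\ge c$ for all atoms $x\le a$, $y\le b$ of $\mathbf A$; (ii) if $a;a\ge a$, then $(x;y)\cdot a\ne 0$ for all atoms $x,y\le a$ of $\mathbf A$. (2) Diversity atoms $a,b,c$ of $\mathbf E$ form a flexible trio if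 $a;a=b;b=c;c=1$, $a;b=a;c=b;c=0'$, and for every atom $x\notin\{1',a,b,c\}$ of $\mathbf E$ at least two of $x;a$, $x;b$, $x;c$ equal $0'$. (3) $\mathbf C_{\mathbf E}(\mathbf A)$ is the complete atomic symmetric algebra in $\mathsf{NA}$ whose atoms are $1'$ and $x^{(i)}$ for all diversity atoms $x$ of $\mathbf A$ and $i\in\omega$, and in which, for atoms $p,q,r$, $p;q\ge r$ holds exactly when $(p,q,r)$ is a permutation of $(1',1',1')$, of some $(1',x^{(i)},x^{(i)})$, or of some $(x^{(i)},y^{(j)},z^{(k)})$ such that $x;y\ge z$ in $\mathbf A$ and, if $x,y,z$ lie below one and the same atom of $\mathbf E$, then $i\le j=k$ or $j\le k=i$ or $k\le i=j$. (4) An atomic relation algebra has the 1-point extension property if whenever $\mu$ is a $k\times k$ matrix of atoms ($k\in\omega$) with $\mu_{ii}\le 1'$, $\breve\mu_{ij}=\mu_{ji}$, $\mu_{il};\mu_{lj}\ge\mu_{ij}$ for all $i,j,l<k$ (a basic matrix), satisfying $\mu_{lm}=1'\iff l=m$ (the identity condition), and $x,y$ are diversity atoms and $i\neq j$ are indices with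 $\mu_{ij}\le x;y$, there is a $(k+1)\times(k+1)$ basic matrix $\mu'$ satisfying the identity condition that extends $\mu$ and has $\mu'_{ik}=x$, $\mu'_{kj}=y$. Theorem. Let $\mathbf A$ be a finite symmetric integral relation algebra that is a special extension of its subalgebra $\mathbf E$, suppose that $\mathbf E$ has a flexible trio, and let $\mathbf B$ be the subalgebra of $\mathbf C_{\mathbf E}(\mathbf A)$ generated by the atoms of $\mathbf C_{\mathbf E}(\mathbf A)$. Then $\mathbf C_{\mathbf E}(\mathbf A)$ is a completion of $\mathbf B$, and (i) every finitely generated subalgebra of $\mathbf B$ is contained in a subalgebra of $\mathbf B$ that is an atomic relation algebra with the 1-point extension property; (ii) $\mathbf B$ is representable; (iii) if $\mathbf A$ has no 1-cycles, i.e. $(u;u)\cdot u=0$ for every atom $u\neq 1'$ of $\mathbf A$, then $\mathbf B$ is not completely representable, $\mathbf C_{\mathbf E}(\mathbf A)$ is not representable, and no completion of $\mathbf B$ (in $\mathsf{NA}$) is representable. -/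

import Mathlib

universe u v w

namespace RelAlg

/-! ### Nonassociative relation algebras and relation algebras -/

/-- A nonassociative relation algebra (a member of `NA`): Tarski's axioms for relation algebras
without the associative law for relative multiplication.  Here `comp` is relative multiplication,
`conv` is conversion and `ide` is the identity element `1'`. -/
class NonassocRelAlgebra (α : Type u) extends BooleanAlgebra α where
  comp : α → α → α
  conv : α → α
  ide : α
  sup_comp : ∀ x y z : α, comp (x ⊔ y) z = comp x z ⊔ comp y z
  comp_ide : ∀ x : α, comp x ide = x
  conv_conv : ∀ x : α, conv (conv x) = x
  conv_sup : ∀ x y : α, conv (x ⊔ y) = conv x ⊔ conv y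
  conv_comp : ∀ x y : α, conv (comp x y) = comp (conv y) (conv x)
  conv_comp_compl_le : ∀ x y : α, comp (conv x) (comp x y)ᶜ ≤ yᶜ

open NonassocRelAlgebra

infixl:75 " ⨾ " => NonassocRelAlgebra.comp

/-- A relation algebra is a nonassociative relation algebra whose relative multiplication is
associative. -/
def IsRelationAlgebra (α : Type u) [NonassocRelAlgebra α] : Prop :=
  ∀ x y z : α, (x ⨾ y) ⨾ z = x ⨾ (y ⨾ z)

/-- Every element is its own converse. -/
def IsSymmetric (α : Type u) [NonassocRelAlgebra α] : Prop :=
  ∀ x : α, conv x = x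

/-- The identity element is an atom. -/
def IsIntegralAlgebra (α : Type u) [NonassocRelAlgebra α] : Prop :=
  IsAtom (ide : α)

/-- A diversity atom is an atom below the diversity element `0' = 1'ᶜ`. -/
def IsDivAtom {α : Type u} [NonassocRelAlgebra α] (x : α) : Prop :=
  IsAtom x ∧ x ≤ (ide : α)ᶜ

/-! ### Subalgebras -/

/-- A subalgebra: a Boolean subalgebra closed under the relational operations. -/
structure Subalg (α : Type u) [NonassocRelAlgebra α] extends BooleanSubalgebra α where
  comp_mem' : ∀ {a b : α}, a ∈ carrier → b ∈ carrier → a ⨾ b ∈ carrier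
  conv_mem' : ∀ {a : α}, a ∈ carrier → conv a ∈ carrier
  ide_mem' : (ide : α) ∈ carrier

namespace Subalg

variable {α : Type u} [NonassocRelAlgebra α]

instance : SetLike (Subalg α) α where
  coe S := S.carrier
  coe_injective S T h := by
    obtain ⟨⟨⟨_, _⟩, _⟩, _⟩ := S
    congr

instance (S : Subalg α) : BooleanAlgebra S :=
  inferInstanceAs (BooleanAlgebra S.toBooleanSubalgebra)

/-- A subalgebra with the operations of the ambient algebra. -/
instance (S : Subalg α) : NonassocRelAlgebra S where
  comp a b := ⟨(a : α) ⨾ b, S.comp_mem' a.2 b.2⟩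
  conv a := ⟨conv (a : α), S.conv_mem' a.2⟩
  ide := ⟨ide, S.ide_mem'⟩
  sup_comp x y z := Subtype.ext (sup_comp (x : α) y z)
  comp_ide x := Subtype.ext (comp_ide (x : α))
  conv_conv x := Subtype.ext (conv_conv (x : α))
  conv_sup x y := Subtype.ext (conv_sup (x : α) y)
  conv_comp x y := Subtype.ext (conv_comp (x : α) y)
  conv_comp_compl_le x y := conv_comp_compl_le (x : α) y

/-- The subalgebra generated by a set: the intersection of all subalgebras containing it. -/
def closure (X : Set α) : Subalg α where
  carrier := {a | ∀ S : Subalg α, X ⊆ S → a ∈ S}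
  supClosed' := fun _ ha _ hb S hS => S.supClosed' (ha S hS) (hb S hS)
  infClosed' := fun _ ha _ hb S hS => S.infClosed' (ha S hS) (hb S hS)
  compl_mem' := fun ha S hS => S.compl_mem' (ha S hS)
  bot_mem' := fun S _ => S.bot_mem'
  comp_mem' := fun ha hb S hS => S.comp_mem' (ha S hS) (hb S hS)
  conv_mem' := fun ha S hS => S.conv_mem' (ha S hS)
  ide_mem' := fun S _ => S.ide_mem'

/-- Finitely generated subalgebras. -/
def FG (S : Subalg α) : Prop :=
  ∃ X : Set α, X.Finite ∧ S = closure X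

variable (α) in
/-- The subalgebra generated by all atoms of the algebra. -/
def atomGenerated : Subalg α := closure {a : α | IsAtom a}

end Subalg

/-! ### Special extensions, flexible trios, 1-cycles -/

/-- `A` is a special extension of its subalgebra `E`. -/
def IsSpecialExtension {A : Type u} [NonassocRelAlgebra A] (E : Subalg A) : Prop :=
  ∀ a b c : E, IsDivAtom a → IsDivAtom b → IsDivAtom c →
    ((¬ (a = b ∧ b = c) → c ≤ a ⨾ b →
        ∀ x y : A, IsAtom x → IsAtom y → x ≤ a → y ≤ b → (c : A) ≤ x ⨾ y) ∧
      (a ≤ a ⨾ a →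
        ∀ x y : A, IsAtom x → IsAtom y → x ≤ a → y ≤ a → (x ⨾ y) ⊓ (a : A) ≠ ⊥))

/-- The diversity atoms `a`, `b`, `c` form a flexible trio. -/
def IsFlexibleTrio {α : Type u} [NonassocRelAlgebra α] (a b c : α) : Prop :=
  (IsDivAtom a ∧ IsDivAtom b ∧ IsDivAtom c) ∧
  (a ⨾ a = ⊤ ∧ b ⨾ b = ⊤ ∧ c ⨾ c = ⊤) ∧
  (a ⨾ b = ideᶜ ∧ a ⨾ c = ideᶜ ∧ b ⨾ c = ideᶜ) ∧
  ∀ x : α, IsAtom x → x ≠ ide → x ≠ a → x ≠ b → x ≠ c →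
    ((x ⨾ a = ideᶜ ∧ x ⨾ b = ideᶜ) ∨ (x ⨾ a = ideᶜ ∧ x ⨾ c = ideᶜ) ∨
      (x ⨾ b = ideᶜ ∧ x ⨾ c = ideᶜ))

/-- `u ⨾ u` is disjoint from `u` for every atom `u` other than the identity. -/
def HasNoOneCycles (α : Type u) [NonassocRelAlgebra α] : Prop :=
  ∀ u : α, IsAtom u → u ≠ ide → (u ⨾ u) ⊓ u = ⊥

/-! ### Basic matrices and the 1-point extension property -/

/-- Basic `k`-by-`k` matrices of atoms. -/
def IsBasicMatrix {α : Type u} [NonassocRelAlgebra α] {k : ℕ} (μ : Fin k → Fin k → α) : Prop :=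
  (∀ i j, IsAtom (μ i j)) ∧
  (∀ i, μ i i ≤ ide) ∧
  (∀ i j, conv (μ i j) = μ j i) ∧
  (∀ i j l, μ i j ≤ μ i l ⨾ μ l j)

/-- The identity condition on a matrix. -/
def IdentityCondition {α : Type u} [NonassocRelAlgebra α] {k : ℕ} (μ : Fin k → Fin k → α) : Prop :=
  ∀ l m, μ l m = ide ↔ l = m

/-- `α` is an atomic relation algebra with the 1-point extension property. -/
def HasOnePointExtension (α : Type u) [NonassocRelAlgebra α] : Prop :=
  IsRelationAlgebra α ∧ IsAtomic α ∧
  ∀ (k : ℕ) (μ : Fin k → Fin k → α), IsBasicMatrix μ → IdentityCondition μ →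
    ∀ (x y : α) (i j : Fin k), IsDivAtom x → IsDivAtom y → i ≠ j → μ i j ≤ x ⨾ y →
      ∃ μ' : Fin (k + 1) → Fin (k + 1) → α, IsBasicMatrix μ' ∧ IdentityCondition μ' ∧
        (∀ l m : Fin k, μ' l.castSucc m.castSucc = μ l m) ∧
        μ' i.castSucc (Fin.last k) = x ∧ μ' (Fin.last k) j.castSucc = y

/-! ### Representations and completions -/

open scoped SetRel in
/-- `ρ` embeds `α` into an algebra of binary relations on `U`: it is injective, sends joins to
unions, complements to complements relative to the unit `ρ ⊤` (which is thereby an equivalence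
relation on `U`), and the relational operations to the corresponding concrete operations. -/
structure IsRepresentation {α : Type u} [NonassocRelAlgebra α] {U : Type v}
    (ρ : α → SetRel U U) : Prop where
  injective : Function.Injective ρ
  map_sup : ∀ a b, ρ (a ⊔ b) = ρ a ∪ ρ b
  map_compl : ∀ a, ρ aᶜ = ρ ⊤ \ ρ a
  map_comp : ∀ a b, ρ (a ⨾ b) = ρ a ○ ρ b
  map_conv : ∀ a, ρ (conv a) = (ρ a).inv
  map_ide : ρ ide = SetRel.id

/-- `α` is representable on some set (in the universe `v`). -/
def IsRepresentable (α : Type u) [NonassocRelAlgebra α] : Prop :=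
  ∃ (U : Type v) (ρ : α → SetRel U U), IsRepresentation ρ

/-- `α` has a representation (in the universe `v`) that preserves all existing joins. -/
def IsCompletelyRepresentable (α : Type u) [NonassocRelAlgebra α] : Prop :=
  ∃ (U : Type v) (ρ : α → SetRel U U), IsRepresentation ρ ∧
    ∀ (X : Set α) (s : α), IsLUB X s → ρ s = ⋃ x ∈ X, ρ x

/-- Embeddings of nonassociative relation algebras. -/
structure IsAlgEmbedding {α : Type u} {β : Type w} [NonassocRelAlgebra α] [NonassocRelAlgebra β]
    (e : α → β) : Prop where
  injective : Function.Injective e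
  map_sup : ∀ a b, e (a ⊔ b) = e a ⊔ e b
  map_compl : ∀ a, e aᶜ = (e a)ᶜ
  map_comp : ∀ a b, e (a ⨾ b) = e a ⨾ e b
  map_conv : ∀ a, e (conv a) = conv (e a)
  map_ide : e ide = ide

/-- `β` is, via the embedding `e`, a completion of `α`: it is complete, and `α` is dense in it. -/
def IsCompletionVia {α : Type u} {β : Type w} [NonassocRelAlgebra α] [NonassocRelAlgebra β]
    (e : α → β) : Prop :=
  IsAlgEmbedding e ∧ (∀ X : Set β, ∃ s, IsLUB X s) ∧ ∀ d : β, d ≠ ⊥ → ∃ a : α, a ≠ ⊥ ∧ e a ≤ d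

/-! ### The complete atomic algebra built from `E ⊆ A` -/

/-- The atoms of the algebra: the identity atom `1'` and the copies `x⁽ⁱ⁾` (`i ∈ ℕ`) of the
diversity atoms `x` of `A`. -/
inductive SplitAtom (A : Type u) [NonassocRelAlgebra A] : Type u where
  | one : SplitAtom A
  | copy (x : A) (hx : IsDivAtom x) (i : ℕ) : SplitAtom A

/-- The thinning condition on triples of indices. -/
def Thin (i j k : ℕ) : Prop :=
  (i ≤ j ∧ j = k) ∨ (j ≤ k ∧ k = i) ∨ (k ≤ i ∧ i = j)

/-- `x`, `y`, `z` have the same cover in `E`, that is, they lie below one atom of `E`. -/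
def SameCover {A : Type u} [NonassocRelAlgebra A] (E : Subalg A) (x y z : A) : Prop :=
  ∃ a : E, IsAtom a ∧ x ≤ a ∧ y ≤ a ∧ z ≤ a

/-- The cycle `[p, q, r]` when every atom is its own converse. -/
def cycleSet {P : Type u} (p q r : P) : Set (P × P × P) :=
  {(p, q, r), (p, r, q), (q, r, p), (q, p, r), (r, p, q), (r, q, p)}

/-- The ternary relation of the atom structure: the union of all its cycles. -/
def cycles {A : Type u} [NonassocRelAlgebra A] (E : Subalg A) :
    Set (SplitAtom A × SplitAtom A × SplitAtom A) :=
  {t | t ∈ cycleSet .one .one .one ∨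
    (∃ x hx i, t ∈ cycleSet .one (.copy x hx i) (.copy x hx i)) ∨
    (∃ x hx i y hy j z hz k, z ≤ x ⨾ y ∧ (SameCover E x y z → Thin i j k) ∧
      t ∈ cycleSet (.copy x hx i) (.copy y hy j) (.copy z hz k))}

/-- The algebra `C_E(A)`: all sets of atoms. -/
def SplitAlgebra {A : Type u} [NonassocRelAlgebra A] (_E : Subalg A) : Type u :=
  Set (SplitAtom A)

namespace SplitAlgebra

variable {A : Type u} [NonassocRelAlgebra A]

instance (E : Subalg A) : BooleanAlgebra (SplitAlgebra E) :=
  inferInstanceAs (BooleanAlgebra (Set (SplitAtom A)))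

/-- Complex relative multiplication. -/
def mul (E : Subalg A) (X Y : Set (SplitAtom A)) : Set (SplitAtom A) :=
  {r | ∃ p ∈ X, ∃ q ∈ Y, (p, q, r) ∈ cycles E}

theorem cycleSet_swap {P : Type u} {p q r a b c : P} (h : (a, b, c) ∈ cycleSet p q r) :
    (b, a, c) ∈ cycleSet p q r ∧ (a, c, b) ∈ cycleSet p q r := by
  simp only [cycleSet, Set.mem_insert_iff, Set.mem_singleton_iff, Prod.mk.injEq] at h ⊢
  tauto

theorem cycles_swap {E : Subalg A} {a b c : SplitAtom A} (h : (a, b, c) ∈ cycles E) :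
    (b, a, c) ∈ cycles E ∧ (a, c, b) ∈ cycles E := by
  rcases h with h | ⟨x, hx, i, h⟩ | ⟨x, hx, i, y, hy, j, z, hz, k, h1, h2, h⟩
  · exact ⟨Or.inl (cycleSet_swap h).1, Or.inl (cycleSet_swap h).2⟩
  · exact ⟨Or.inr (Or.inl ⟨x, hx, i, (cycleSet_swap h).1⟩),
      Or.inr (Or.inl ⟨x, hx, i, (cycleSet_swap h).2⟩)⟩
  · exact ⟨Or.inr (Or.inr ⟨x, hx, i, y, hy, j, z, hz, k, h1, h2, (cycleSet_swap h).1⟩),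
      Or.inr (Or.inr ⟨x, hx, i, y, hy, j, z, hz, k, h1, h2, (cycleSet_swap h).2⟩)⟩

theorem cycles_one {E : Subalg A} {p r : SplitAtom A} :
    (p, SplitAtom.one, r) ∈ cycles E ↔ r = p := by
  constructor
  · rintro (h | ⟨x, hx, i, h⟩ | ⟨x, hx, i, y, hy, j, z, hz, k, h1, h2, h⟩)
    · simp only [cycleSet, Set.mem_insert_iff, Set.mem_singleton_iff, Prod.mk.injEq] at h
      grind
    · simp only [cycleSet, Set.mem_insert_iff, Set.mem_singleton_iff, Prod.mk.injEq] at h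
      grind
    · simp only [cycleSet, Set.mem_insert_iff, Set.mem_singleton_iff, Prod.mk.injEq] at h
      grind
  · rintro rfl
    cases r with
    | one => exact Or.inl (by simp [cycleSet])
    | copy x hx i => exact Or.inr (Or.inl ⟨x, hx, i, by simp [cycleSet]⟩)

/-- The complex algebra: every atom, hence every element, is its own converse, the identity
element is `{1'}`, and the relative product is the complex product. -/
instance (E : Subalg A) : NonassocRelAlgebra (SplitAlgebra E) where
  comp X Y := mul E X Y
  conv X := X
  ide := ({SplitAtom.one} : Set (SplitAtom A))
  sup_comp X Y Z := by
    refine Set.ext fun r => ⟨?_, ?_⟩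
    · rintro ⟨p, hp | hp, q, hq, h⟩
      · exact Or.inl ⟨p, hp, q, hq, h⟩
      · exact Or.inr ⟨p, hp, q, hq, h⟩
    · rintro (⟨p, hp, q, hq, h⟩ | ⟨p, hp, q, hq, h⟩)
      · exact ⟨p, Or.inl hp, q, hq, h⟩
      · exact ⟨p, Or.inr hp, q, hq, h⟩
  comp_ide X := by
    refine Set.ext fun r => ⟨?_, fun hr => ⟨r, hr, _, rfl, cycles_one.2 rfl⟩⟩
    rintro ⟨p, hp, q, rfl, h⟩
    rw [cycles_one.1 h]
    exact hp
  conv_conv _ := rfl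
  conv_sup _ _ := rfl
  conv_comp X Y := by
    refine Set.ext fun r => ⟨?_, ?_⟩ <;>
    · rintro ⟨p, hp, q, hq, h⟩
      exact ⟨q, hq, p, hp, (cycles_swap h).1⟩
  conv_comp_compl_le X Y := by
    rintro r ⟨p, hp, q, hq, h⟩ hr
    exact hq ⟨p, hp, r, hr, (cycles_swap h).2⟩

end SplitAlgebra

end RelAlg

open RelAlg

/-!
# Completions of the atom-generated subalgebra

Write `R x y z` for `z ≤ x ⨾ y` on the diversity atoms of `A`, and let `c` send a diversity atom to
the atom of `E` above it. Special extension says that `R` depends only on the blocks of `c` when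
the three blocks do not coincide, and that triples within one block are plentiful (`IsCover`).
Adjoin to the atoms `x⁽ⁱ⁾` of the algebra one limit label `inf d` for every block `d`, with index
`∞`, and extend the cycles to these labels by the same thinning condition (`Label.Tri`). The sets
of atoms that do not distinguish atoms of index at least `n` in one block form a subalgebra
(`SplitAlgebra.level`), whose atoms are the labels with index less than `n` or `∞`, with exactly
these cycles (`Label.exists_fine_tri_iff`).

A flexible trio makes the labels a *flexible frame* (`Label.isFlexibleFrame`): given two diversity
labels `x`, `y`, each of them excludes at most one of the three limit labels of the trio, so that
one of the three forms a cycle with `x` and any third diversity label, and also with `y` and any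
third diversity label. To extend a network by a new point with labels `x` and `y` to two given
points it is enough to put this limit label everywhere else. This gives the 1-point extension
property and associativity of the levels, and, as the labels are countable, a saturated network on
`ℕ` labelled by all labels. The latter represents every subalgebra whose elements belong to levels:
an element relates two points if it contains almost all atoms near their label.

Every element of the atom-generated subalgebra `B` belongs to a level for the cover by atoms of `E`,
but these levels need not be contained in `B`: there may be distinct blocks that no element of `B`
separates. Identify diversity atoms if no element of `B` separates their copies of large index
(`SplitAlgebra.limitCover`). Because of thinning, no cycle of `A` runs between different blocks of
`E` that are identified, and a block of `E` that contains a cycle is identified with no other. So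
the coarser cover satisfies the same hypotheses with the same thinning condition, the trio survives,
and the union of its levels is `B`.

For the negative part, all copies of one fixed atom of `A` occur as labels `x⁽ⁱ⁾` of the pairs
issuing from a single point of a representation, so some class of the unit is infinite. In a
complete representation of `B`, or a representation of a completion, the pairs of distinct points in
that class are coloured with the finitely many diversity atoms of `A`: the colour of a pair is the
`x` one of whose copies (or the join of whose copies) contains it. An infinite set of points has a
monochromatic triangle, which yields a 1-cycle of `A`.
-/

namespace RelAlg

open NonassocRelAlgebra

/-! ### Arithmetic of nonassociative relation algebras -/

section Arithmetic

variable {α : Type u} [NonassocRelAlgebra α]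

theorem conv_mono {x y : α} (h : x ≤ y) : conv x ≤ conv y := by
  rw [← sup_eq_right] at h ⊢
  rw [← conv_sup, h]

/-- Conversion is an automorphism of the underlying order. -/
def convIso (α : Type u) [NonassocRelAlgebra α] : α ≃o α where
  toFun := conv
  invFun := conv
  left_inv := conv_conv
  right_inv := conv_conv
  map_rel_iff' := by
    intro a b
    refine ⟨fun h => ?_, conv_mono⟩
    simpa [conv_conv] using conv_mono h

theorem disjoint_conv_iff {x y : α} : Disjoint (conv x) (conv y) ↔ Disjoint x y :=
  disjoint_map_orderIso_iff (convIso α)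

theorem comp_mono_left {x y : α} (z : α) (h : x ≤ y) : x ⨾ z ≤ y ⨾ z := by
  rw [← sup_eq_right] at h ⊢
  rw [← sup_comp, h]

theorem comp_mono_right {x y : α} (z : α) (h : x ≤ y) : z ⨾ x ≤ z ⨾ y := by
  have := conv_mono (comp_mono_left (conv z) (conv_mono h))
  simpa only [conv_comp, conv_conv] using this

theorem comp_mono {x y z t : α} (h : x ≤ y) (h' : z ≤ t) : x ⨾ z ≤ y ⨾ t :=
  (comp_mono_left z h).trans (comp_mono_right y h')

/-- The Peircean law, rotating the second factor with the result. -/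
theorem disjoint_comp_right {x y z : α} : Disjoint (x ⨾ y) z ↔ Disjoint (conv x ⨾ z) y := by
  have key : ∀ x y z : α, Disjoint (x ⨾ y) z → Disjoint (conv x ⨾ z) y := by
    intro x y z h
    have h1 : z ≤ (x ⨾ y)ᶜ := h.symm.le_compl_right
    exact le_compl_iff_disjoint_right.1
      ((comp_mono_right (conv x) h1).trans (conv_comp_compl_le x y))
  refine ⟨key x y z, fun h => ?_⟩
  have := key _ _ _ h
  rwa [conv_conv] at this

/-- The Peircean law, rotating the first factor with the result. -/
theorem disjoint_comp_left {x y z : α} : Disjoint (x ⨾ y) z ↔ Disjoint (z ⨾ conv y) x := by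
  rw [← disjoint_conv_iff, conv_comp, disjoint_comp_right, ← disjoint_conv_iff]
  simp only [conv_comp, conv_conv]

theorem IsSymmetric.comp_comm (h : IsSymmetric α) (x y : α) : x ⨾ y = y ⨾ x := by
  rw [← h (x ⨾ y), conv_comp, h, h]

theorem le_of_forall_atom_le [IsAtomic α] {x y : α} (h : ∀ p, IsAtom p → p ≤ x → p ≤ y) :
    x ≤ y := by
  rw [← disjoint_compl_right_iff, disjoint_iff]
  by_contra h0
  obtain ⟨p, hp, hle⟩ := (IsAtomic.eq_bot_or_exists_atom_le (x ⊓ yᶜ)).resolve_left h0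
  have h1 := h p hp (hle.trans inf_le_left)
  exact hp.1 (le_bot_iff.1 ((le_inf h1 (hle.trans inf_le_right)).trans inf_compl_eq_bot.le))

theorem le_comp_rotate (h : IsSymmetric α) {x y z : α} (hy : IsAtom y) (hz : IsAtom z)
    (hle : z ≤ x ⨾ y) : y ≤ x ⨾ z := by
  have h1 : ¬ Disjoint (x ⨾ y) z := fun hd => hz.1 (le_bot_iff.1 (hd hle le_rfl))
  rw [disjoint_comp_right, h] at h1
  exact (hy.not_disjoint_iff_le).1 fun hd => h1 hd.symm

/-- In an atomic algebra every atom below a product is below a product of atoms. -/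
theorem exists_atoms_le_comp [IsAtomic α] {x y z : α} (hz : IsAtom z) (hle : z ≤ x ⨾ y) :
    ∃ p q, IsAtom p ∧ IsAtom q ∧ p ≤ x ∧ q ≤ y ∧ z ≤ p ⨾ q := by
  have h0 : ∀ {s t : α}, ¬ Disjoint s t → ∃ p, IsAtom p ∧ p ≤ s ∧ p ≤ t := by
    intro s t h
    obtain h1 | ⟨p, hp, hle⟩ := IsAtomic.eq_bot_or_exists_atom_le (s ⊓ t)
    · exact absurd (disjoint_iff.2 h1) h
    · exact ⟨p, hp, hle.trans inf_le_left, hle.trans inf_le_right⟩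
  have h1 : ¬ Disjoint (x ⨾ y) z := fun hd => hz.1 (le_bot_iff.1 (hd hle le_rfl))
  rw [disjoint_comp_left] at h1
  obtain ⟨p, hp, hp1, hp2⟩ := h0 h1
  have h2 : ¬ Disjoint (z ⨾ conv y) p := fun hd => hp.1 (le_bot_iff.1 (hd hp1 le_rfl))
  rw [← disjoint_comp_left, disjoint_comp_right] at h2
  obtain ⟨q, hq, hq1, hq2⟩ := h0 h2
  have h3 : ¬ Disjoint (conv p ⨾ z) q := fun hd => hq.1 (le_bot_iff.1 (hd hq1 le_rfl))
  rw [← disjoint_comp_right] at h3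
  exact ⟨p, q, hp, hq, hp2, hq2, hz.not_disjoint_iff_le.1 fun hd => h3 hd.symm⟩

end Arithmetic

/-! ### Flexible frames -/

/-- A symmetric atom structure with identity `one` and cycles `T`, together with a set `F` of
diversity atoms that are flexible: two of them are consistent with every diversity atom, and any two
diversity atoms have a common member of `F` that forms a cycle with each of them and every third
diversity atom. -/
structure IsFlexibleFrame {L : Type u} (one : L) (T : L → L → L → Prop) (F : Set L) : Prop where
  swap_left : ∀ {p q r}, T p q r → T q p r
  swap_right : ∀ {p q r}, T p q r → T p r q
  one_iff : ∀ {q r}, T one q r ↔ q = r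
  nonempty : F.Nonempty
  ne_one : ∀ {t}, t ∈ F → t ≠ one
  pair : ∀ {t t' q}, t ∈ F → t' ∈ F → q ≠ one → T t t' q
  common : ∀ {x y}, x ≠ one → y ≠ one → ∃ t ∈ F, ∀ q, q ≠ one → T t x q ∧ T t y q

/-- A consistent labelling of the pairs of points of `s` by atoms. -/
structure IsNetworkOn {L : Type u} {ι : Type v} (one : L) (T : L → L → L → Prop) (s : Set ι)
    (N : ι → ι → L) : Prop where
  eq_one_iff : ∀ {i j}, i ∈ s → j ∈ s → (N i j = one ↔ i = j)
  symm : ∀ {i j}, i ∈ s → j ∈ s → N i j = N j i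
  tri : ∀ {i j l}, i ∈ s → j ∈ s → l ∈ s → T (N i l) (N l j) (N i j)

namespace IsFlexibleFrame

variable {L : Type u} {one : L} {T : L → L → L → Prop} {F : Set L}

theorem one_right (hF : IsFlexibleFrame one T F) (p : L) : T p p one :=
  hF.swap_right (hF.swap_left (hF.one_iff.2 rfl))

theorem exists_factor (hF : IsFlexibleFrame one T F) {x q : L} (hx : x ≠ one) (hq : q ≠ one) :
    ∃ y, y ≠ one ∧ T x y q := by
  obtain ⟨t, ht, h⟩ := hF.common hx hx
  exact ⟨t, hF.ne_one ht, hF.swap_left (h q hq).1⟩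

/-- Associativity of the complex algebra of a flexible frame, in terms of atoms. -/
theorem assoc (hF : IsFlexibleFrame one T F) {p q r s t : L} (h1 : T p q r) (h2 : T r s t) :
    ∃ m, T q s m ∧ T p m t := by
  have sl := @hF.swap_left
  have sr := @hF.swap_right
  have h1i := @hF.one_iff
  by_cases hp : p = one
  · subst hp; obtain rfl := h1i.1 h1; exact ⟨t, h2, h1i.2 rfl⟩
  by_cases hq : q = one
  · subst hq; obtain rfl := h1i.1 (sl h1); exact ⟨s, h1i.2 rfl, h2⟩
  by_cases hs : s = one
  · subst hs; obtain rfl := h1i.1 (sl h2); exact ⟨q, sl (h1i.2 rfl), h1⟩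
  by_cases ht : t = one
  · subst ht; obtain rfl := h1i.1 (sl (sr h2)); exact ⟨p, sr (sl h1), hF.one_right p⟩
  obtain ⟨m, -, hm⟩ := hF.common hp hq
  exact ⟨m, sr (sl (hm s hs).2), sl (hm t ht).1⟩

/-- The one-point extension of a network: the labels of the pairs formed with the new point can be
chosen to be `x`, `y` at the prescribed points and in `F` elsewhere. -/
theorem exists_extension (hF : IsFlexibleFrame one T F) {ι : Type v} {s : Set ι} {N : ι → ι → L}
    (hN : IsNetworkOn one T s N) {x y : L} {i j : ι} (hi : i ∈ s) (hj : j ∈ s)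
    (hx : x ≠ one) (hy : y ≠ one) (hij : i ≠ j) (h : T x y (N i j)) :
    ∃ v : ι → L, v i = x ∧ v j = y ∧ (∀ l, v l ≠ one) ∧
      ∀ l ∈ s, ∀ m ∈ s, T (v l) (v m) (N l m) := by
  classical
  obtain ⟨t, ht, htx⟩ := hF.common hx hy
  have htN := hF.ne_one ht
  refine ⟨fun l => if l = i then x else if l = j then y else t, by simp, by simp [hij.symm],
    fun l => by dsimp only; split_ifs <;> assumption, fun l hl m hm => ?_⟩
  by_cases hlm : l = m
  · subst hlm
    rw [(hN.eq_one_iff hl hl).2 rfl]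
    exact hF.one_right _
  have hne : N l m ≠ one := fun h => hlm ((hN.eq_one_iff hl hm).1 h)
  have a1 := (htx _ hne).1
  have a2 := (htx _ hne).2
  have a3 := hF.pair ht ht hne
  have a1' := hF.swap_left a1
  have a2' := hF.swap_left a2
  by_cases h1 : l = i <;> by_cases h2 : l = j <;> by_cases h3 : m = i <;> by_cases h4 : m = j <;>
    simp only [h1, h2, h3, h4, hij, hij.symm, if_true, if_false] at * <;>
    first
    | contradiction
    | assumption
    | (rw [hN.symm hj hi]; exact hF.swap_left h)

theorem exists_trivial_extension (hF : IsFlexibleFrame one T F) {ι : Type v} {s : Set ι}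
    {N : ι → ι → L} (hN : IsNetworkOn one T s N) :
    ∃ v : ι → L, (∀ l, v l ≠ one) ∧ ∀ l ∈ s, ∀ m ∈ s, T (v l) (v m) (N l m) := by
  obtain ⟨t, ht⟩ := hF.nonempty
  refine ⟨fun _ => t, fun _ => hF.ne_one ht, fun l hl m hm => ?_⟩
  by_cases hlm : l = m
  · rw [(hN.eq_one_iff hl hm).2 hlm]
    exact hF.one_right _
  · exact hF.pair ht ht fun h => hlm ((hN.eq_one_iff hl hm).1 h)

end IsFlexibleFrame

/-- Adding one point with labels `v` to a network. -/
theorem IsNetworkOn.insert {L : Type u} {one : L} {T : L → L → L → Prop} {F : Set L}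
    (hF : IsFlexibleFrame one T F) {ι : Type v} {κ : Type w} {s : Set ι} {N : ι → ι → L}
    (hN : IsNetworkOn one T s N) {v : ι → L} (hv : ∀ l, v l ≠ one)
    (hvN : ∀ l ∈ s, ∀ m ∈ s, T (v l) (v m) (N l m)) {s' : Set κ} {N' : κ → κ → L} {k : κ}
    (f : ι → κ) (hf : ∀ l ∈ s, ∀ m ∈ s, f l = f m → l = m) (hk : ∀ l ∈ s, f l ≠ k)
    (hs : ∀ a ∈ s', a = k ∨ ∃ l ∈ s, a = f l)
    (h1 : ∀ l ∈ s, ∀ m ∈ s, N' (f l) (f m) = N l m) (h2 : ∀ l ∈ s, N' (f l) k = v l)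
    (h3 : ∀ l ∈ s, N' k (f l) = v l) (h4 : N' k k = one) : IsNetworkOn one T s' N' := by
  have sl := @hF.swap_left
  have sr := @hF.swap_right
  constructor
  · intro a b ha hb
    rcases hs a ha with rfl | ⟨l, hl, rfl⟩ <;> rcases hs b hb with rfl | ⟨m, hm, rfl⟩
    · simp [h4]
    · simp [h3 m hm, hv m, (hk m hm).symm]
    · simp [h2 l hl, hv l, hk l hl]
    · rw [h1 l hl m hm, hN.eq_one_iff hl hm]
      exact ⟨fun h => h ▸ rfl, hf l hl m hm⟩
  · intro a b ha hb
    rcases hs a ha with rfl | ⟨l, hl, rfl⟩ <;> rcases hs b hb with rfl | ⟨m, hm, rfl⟩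
    · rfl
    · rw [h3 m hm, h2 m hm]
    · rw [h3 l hl, h2 l hl]
    · rw [h1 l hl m hm, h1 m hm l hl, hN.symm hl hm]
  · intro a b c ha hb hc
    rcases hs a ha with rfl | ⟨l, hl, rfl⟩ <;> rcases hs b hb with rfl | ⟨m, hm, rfl⟩ <;>
      rcases hs c hc with rfl | ⟨n, hn, rfl⟩
    · rw [h4]; exact hF.one_right _
    · rw [h4, h2 n hn, h3 n hn]; exact hF.one_right _
    · rw [h4, h3 m hm]; exact hF.one_iff.2 rfl
    · rw [h3 m hm, h3 n hn, h1 n hn m hm]; exact sr (hvN n hn m hm)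
    · rw [h4, h2 l hl]; exact sl (hF.one_iff.2 rfl)
    · rw [h2 l hl, h2 n hn, h1 l hl n hn]; exact sl (sr (sl (hvN l hl n hn)))
    · rw [h2 l hl, h3 m hm, h1 l hl m hm]; exact hvN l hl m hm
    · rw [h1 l hl m hm, h1 l hl n hn, h1 n hn m hm]; exact hN.tri hl hm hn

/-- A countable flexible frame has a saturated network on `ℕ`: one in which every consistent
prescription of the labels from a new point to two given points is realized. -/
theorem IsFlexibleFrame.exists_saturated {L : Type u} [Countable L] {one : L}
    {T : L → L → L → Prop} {F : Set L} (hF : IsFlexibleFrame one T F) :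
    ∃ N : ℕ → ℕ → L, IsNetworkOn one T Set.univ N ∧
      ∀ i j x y, i ≠ j → x ≠ one → y ≠ one → T x y (N i j) → ∃ k, N i k = x ∧ N k j = y := by
  classical
  have : Nonempty L := ⟨one⟩
  obtain ⟨e, he⟩ := exists_surjective_nat (ℕ × ℕ × L × L)
  let task : ℕ → ℕ × ℕ × L × L := fun n => e n.unpair.2
  have htask : ∀ a m, ∃ n, m ≤ n ∧ task n = a := by
    intro a m
    obtain ⟨k, rfl⟩ := he a
    exact ⟨Nat.pair m k, Nat.left_le_pair m k, by simp [task]⟩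
  have step : ∀ n (N : ℕ → ℕ → L), IsNetworkOn one T {i | i < n} N → ∃ N' : ℕ → ℕ → L,
      IsNetworkOn one T {i | i < n + 1} N' ∧ (∀ i < n, ∀ j < n, N' i j = N i j) ∧
      ∀ i j x y, task n = (i, j, x, y) → i < n → j < n → i ≠ j → x ≠ one → y ≠ one →
        T x y (N i j) → N' i n = x ∧ N' n j = y := by
    intro n N hN
    have main : ∀ v : ℕ → L, (∀ l, v l ≠ one) →
        (∀ l ∈ {i | i < n}, ∀ m ∈ {i | i < n}, T (v l) (v m) (N l m)) →
        ∃ N' : ℕ → ℕ → L, IsNetworkOn one T {i | i < n + 1} N' ∧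
          (∀ i < n, ∀ j < n, N' i j = N i j) ∧ (∀ l < n, N' l n = v l ∧ N' n l = v l) := by
      intro v hv hvN
      refine ⟨fun a b => if a = n then (if b = n then one else v b) else
        if b = n then v a else N a b, ?_, ?_, ?_⟩
      · refine hN.insert hF hv hvN (k := n) id (fun _ _ _ _ h => h) (fun l hl => hl.ne)
          ?_ ?_ ?_ ?_ ?_
        · intro a ha
          rcases Nat.lt_succ_iff_lt_or_eq.1 ha with h | h
          · exact Or.inr ⟨a, h, rfl⟩
          · exact Or.inl h
        · intro l hl m hm
          simp [(show l ≠ n from hl.ne), (show m ≠ n from hm.ne)]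
        · intro l hl
          simp [(show l ≠ n from hl.ne)]
        · intro l hl
          simp [(show l ≠ n from hl.ne)]
        · simp
      · intro i hi j hj
        simp [hi.ne, hj.ne]
      · intro l hl
        simp [hl.ne]
    by_cases h : (task n).1 < n ∧ (task n).2.1 < n ∧ (task n).1 ≠ (task n).2.1 ∧
        (task n).2.2.1 ≠ one ∧ (task n).2.2.2 ≠ one ∧
        T (task n).2.2.1 (task n).2.2.2 (N (task n).1 (task n).2.1)
    · obtain ⟨hi, hj, hij, hx, hy, hT⟩ := h
      obtain ⟨v, hvi, hvj, hv, hvN⟩ := hF.exists_extension hN hi hj hx hy hij hT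
      obtain ⟨N', h1, h2, h3⟩ := main v hv hvN
      refine ⟨N', h1, h2, ?_⟩
      intro i j x y ht hi' hj' _ _ _ _
      rw [ht] at hvi hvj
      exact ⟨(h3 i hi').1.trans hvi, (h3 j hj').2.trans hvj⟩
    · obtain ⟨v, hv, hvN⟩ := hF.exists_trivial_extension hN
      obtain ⟨N', h1, h2, h3⟩ := main v hv hvN
      refine ⟨N', h1, h2, ?_⟩
      intro i j x y ht hi' hj' hij hx hy hT
      rw [ht] at h
      exact absurd ⟨hi', hj', hij, hx, hy, hT⟩ h
  choose! next hnext using step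
  let seq : ℕ → ℕ → ℕ → L := fun n => Nat.rec (fun _ _ => one) (fun n N => next n N) n
  have hseq : ∀ n, IsNetworkOn one T {i | i < n} (seq n) := by
    intro n
    induction n with
    | zero => constructor <;> intro i <;> simp
    | succ n ih => exact (hnext n _ ih).1
  have hagree : ∀ i j n, i < n → j < n → seq n i j = seq (max i j + 1) i j := by
    intro i j n hi hj
    have hn : max i j + 1 ≤ n := by omega
    induction n, hn using Nat.le_induction with
    | base => rfl
    | succ n hn ih =>
      have hi' : i < n := by omega
      have hj' : j < n := by omega
      rw [← ih hi' hj']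
      exact (hnext n _ (hseq n)).2.1 i hi' j hj'
  refine ⟨fun i j => seq (max i j + 1) i j, ⟨?_, ?_, ?_⟩, ?_⟩
  · intro i j _ _
    exact (hseq (max i j + 1)).eq_one_iff (show i < _ by omega) (show j < _ by omega)
  · intro i j _ _
    rw [max_comm j i]
    exact (hseq (max i j + 1)).symm (show i < _ by omega) (show j < _ by omega)
  · intro i j l _ _ _
    have hi : i < max (max i j) l + 1 := by omega
    have hj : j < max (max i j) l + 1 := by omega
    have hl : l < max (max i j) l + 1 := by omega
    rw [← hagree i j _ hi hj, ← hagree i l _ hi hl, ← hagree l j _ hl hj]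
    exact (hseq _).tri hi hj hl
  · intro i j x y hij hx hy hT
    obtain ⟨n, hn, ht⟩ := htask (i, j, x, y) (max i j + 1)
    have hi : i < n := by omega
    have hj : j < n := by omega
    dsimp only at hT
    rw [← hagree i j n hi hj] at hT
    obtain ⟨h1, h2⟩ := (hnext n _ (hseq n)).2.2 i j x y ht hi hj hij hx hy hT
    refine ⟨n, ?_, ?_⟩
    · dsimp only
      rw [← hagree i n (n + 1) (by omega) (by omega)]
      exact h1
    · dsimp only
      rw [← hagree n j (n + 1) (by omega) (by omega)]
      exact h2

/-- If the atoms of an atomic algebra form a flexible frame, then the algebra is a relation algebra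
with the 1-point extension property. -/
theorem IsFlexibleFrame.hasOnePointExtension {L : Type u} {one : L} {T : L → L → L → Prop}
    {F : Set L} (hF : IsFlexibleFrame one T F) {α : Type v} [NonassocRelAlgebra α] [IsAtomic α]
    (hα : IsSymmetric α) (φ : L → α) (hinj : Function.Injective φ)
    (hφ : ∀ a, IsAtom a ↔ ∃ p, φ p = a) (hone : φ one = ide)
    (hT : ∀ p q r, φ r ≤ φ p ⨾ φ q ↔ T p q r) : HasOnePointExtension α := by
  have hat : ∀ p, IsAtom (φ p) := fun p => (hφ _).2 ⟨p, rfl⟩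
  have le_comp : ∀ x y z : α, (x ⨾ y) ⨾ z ≤ x ⨾ (y ⨾ z) := by
    intro x y z
    refine le_of_forall_atom_le fun t ht hle => ?_
    obtain ⟨r, s, hr, hs, hr1, hs1, h1⟩ := exists_atoms_le_comp ht hle
    obtain ⟨p, q, hp, hq, hp1, hq1, h2⟩ := exists_atoms_le_comp hr hr1
    obtain ⟨t, rfl⟩ := (hφ _).1 ht
    obtain ⟨r, rfl⟩ := (hφ _).1 hr
    obtain ⟨s, rfl⟩ := (hφ _).1 hs
    obtain ⟨p, rfl⟩ := (hφ _).1 hp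
    obtain ⟨q, rfl⟩ := (hφ _).1 hq
    obtain ⟨m, hm1, hm2⟩ := hF.assoc ((hT _ _ _).1 h2) ((hT _ _ _).1 h1)
    exact ((hT _ _ _).2 hm2).trans
      (comp_mono hp1 (((hT _ _ _).2 hm1).trans (comp_mono hq1 hs1)))
  refine ⟨fun x y z => le_antisymm (le_comp x y z) ?_, inferInstance, ?_⟩
  · rw [hα.comp_comm x (y ⨾ z), hα.comp_comm y z, hα.comp_comm x y, hα.comp_comm (y ⨾ x) z]
    exact le_comp z y x
  intro k μ hμ hid x y i j hx hy hij hle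
  choose N hN using fun i j => (hφ _).1 (hμ.1 i j)
  obtain ⟨x, rfl⟩ := (hφ _).1 hx.1
  obtain ⟨y, rfl⟩ := (hφ _).1 hy.1
  have hdiv : ∀ p, IsDivAtom (φ p) → p ≠ one := by
    rintro p hp rfl
    have h1 := hp.2
    rw [hone] at h1
    refine (hat p).1 ?_
    rw [hone]
    exact le_compl_self.1 h1
  have hNet : IsNetworkOn one T Set.univ N := by
    refine ⟨?_, ?_, ?_⟩
    · intro l m _ _
      rw [← hid l m, ← hN l m, ← hone]
      exact hinj.eq_iff.symm
    · intro l m _ _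
      apply hinj
      rw [hN, hN, ← hμ.2.2.1 l m, hα]
    · intro l m n _ _ _
      rw [← hT, hN, hN, hN]
      exact hμ.2.2.2 l m n
  rw [← hN i j, hT] at hle
  obtain ⟨v, hvi, hvj, hv, hvN⟩ := hF.exists_extension hNet (Set.mem_univ i) (Set.mem_univ j)
    (hdiv _ hx) (hdiv _ hy) hij hle
  let N' : Fin (k + 1) → Fin (k + 1) → L := fun a b =>
    Fin.lastCases (Fin.lastCases one (fun m => v m) b)
      (fun l => Fin.lastCases (v l) (fun m => N l m) b) a
  have h1 : ∀ l m : Fin k, N' l.castSucc m.castSucc = N l m := by simp [N']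
  have h2 : ∀ l : Fin k, N' l.castSucc (Fin.last k) = v l := by simp [N']
  have h3 : ∀ l : Fin k, N' (Fin.last k) l.castSucc = v l := by simp [N']
  have h4 : N' (Fin.last k) (Fin.last k) = one := by simp [N']
  have hNet' : IsNetworkOn one T Set.univ N' := by
    refine hNet.insert hF hv hvN (k := Fin.last k) Fin.castSucc
      (fun _ _ _ _ h => Fin.castSucc_injective _ h) (fun l _ => Fin.castSucc_ne_last l) ?_
      (fun l _ m _ => h1 l m) (fun l _ => h2 l) (fun l _ => h3 l) h4
    intro a _
    induction a using Fin.lastCases with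
    | last => exact Or.inl rfl
    | cast l => exact Or.inr ⟨l, trivial, rfl⟩
  refine ⟨fun a b => φ (N' a b), ⟨fun a b => hat _, fun a => ?_, fun a b => ?_, fun a b c => ?_⟩,
    fun a b => ?_, fun l m => ?_, ?_, ?_⟩
  · exact ((congrArg φ ((hNet'.eq_one_iff (Set.mem_univ a) (Set.mem_univ a)).2 rfl)).trans hone).le
  · dsimp only
    rw [hα, hNet'.symm (Set.mem_univ a) (Set.mem_univ b)]
  · exact (hT _ _ _).2 (hNet'.tri (Set.mem_univ a) (Set.mem_univ b) (Set.mem_univ c))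
  · rw [← hNet'.eq_one_iff (Set.mem_univ a) (Set.mem_univ b), ← hone]
    exact hinj.eq_iff
  · dsimp only
    rw [h1, hN]
  · dsimp only
    rw [h2, hvi]
  · dsimp only
    rw [h3, hvj]

/-! ### Covers and limit labels -/

/-- A cover of a symmetric ternary relation `R`: whether `R x y z` holds depends only on the blocks
of `x`, `y`, `z` unless these coincide, and inside a block which contains some triple of `R`, any
two elements belong to a triple. -/
structure IsCover {α : Type u} {κ : Type v} (R : α → α → α → Prop) (c : α → κ) : Prop where
  surjective : Function.Surjective c
  swap_left : ∀ {x y z}, R x y z → R y x z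
  swap_right : ∀ {x y z}, R x y z → R x z y
  uniform : ∀ {x y z x' y' z'}, R x y z → ¬ (c x = c y ∧ c y = c z) → c x' = c x → c y' = c y →
    c z' = c z → R x' y' z'
  extend : ∀ {x y z y' z'}, R x y z → c x = c y → c y = c z → c y' = c x → c z' = c x →
    ∃ x', c x' = c x ∧ R x' y' z'

/-- The three distinct blocks `t 0`, `t 1`, `t 2` form a flexible trio of the relation induced on
the blocks. -/
structure IsTrio {α : Type u} {κ : Type v} (R : α → α → α → Prop) (c : α → κ) (t : Fin 3 → κ) :
    Prop where
  injective : Function.Injective t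
  pair : ∀ i j e, ∃ x y z, c x = t i ∧ c y = t j ∧ c z = e ∧ R x y z
  other : ∀ d, ∃ i, ∀ j, j ≠ i → ∀ e, ∃ x y z, c x = d ∧ c y = t j ∧ c z = e ∧ R x y z

/-- The largest of the three values is attained at least twice. -/
def TwiceMax {β : Type u} [LE β] (i j k : β) : Prop :=
  (i ≤ j ∧ j = k) ∨ (j ≤ k ∧ k = i) ∨ (k ≤ i ∧ i = j)

theorem TwiceMax.map {β : Type u} {γ : Type v} [Preorder β] [Preorder γ] {f : β → γ}
    (hf : Monotone f) {i j k : β} (h : TwiceMax i j k) : TwiceMax (f i) (f j) (f k) := by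
  rcases h with ⟨h1, rfl⟩ | ⟨h1, rfl⟩ | ⟨h1, rfl⟩
  · exact Or.inl ⟨hf h1, rfl⟩
  · exact Or.inr (Or.inl ⟨hf h1, rfl⟩)
  · exact Or.inr (Or.inr ⟨hf h1, rfl⟩)

theorem TwiceMax.swap_left {β : Type u} [PartialOrder β] {i j k : β} (h : TwiceMax i j k) :
    TwiceMax j i k := by
  rcases h with ⟨h1, rfl⟩ | ⟨h1, rfl⟩ | ⟨h1, rfl⟩
  · exact Or.inr (Or.inl ⟨h1, rfl⟩)
  · exact Or.inl ⟨h1, rfl⟩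
  · exact Or.inr (Or.inr ⟨h1, rfl⟩)

theorem TwiceMax.swap_right {β : Type u} [PartialOrder β] {i j k : β} (h : TwiceMax i j k) :
    TwiceMax i k j := by
  rcases h with ⟨h1, rfl⟩ | ⟨h1, rfl⟩ | ⟨h1, rfl⟩
  · exact Or.inl ⟨h1, rfl⟩
  · exact Or.inr (Or.inr ⟨h1, rfl⟩)
  · exact Or.inr (Or.inl ⟨h1, rfl⟩)

/-- Labels: the identity, the copies `fin x i` of the elements of `α`, and for every block `d` a
limit label `inf d`, which stands for the copies with arbitrarily large index of the elements of
that block. -/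
inductive Label (α : Type u) (κ : Type v) : Type (max u v) where
  | one : Label α κ
  | fin (x : α) (i : ℕ) : Label α κ
  | inf (d : κ) : Label α κ

namespace Label

variable {α : Type u} {κ : Type v} {R : α → α → α → Prop} {c : α → κ}

instance [Countable α] [Countable κ] : Countable (Label α κ) := by
  let f : Label α κ → Option (α × ℕ ⊕ κ) := fun q => match q with
    | one => none
    | fin x i => some (.inl (x, i))
    | inf d => some (.inr d)
  refine Function.Injective.countable (f := f) ?_
  intro p q h
  cases p <;> cases q <;> simp_all [f]

/-- The elements of which a label is a copy or limit. -/
def under (c : α → κ) : Label α κ → Set α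
  | one => ∅
  | fin x _ => {x}
  | inf d => {x | c x = d}

/-- The index of a label, infinite for limit labels; the value at `one` is irrelevant. -/
def idx : Label α κ → ℕ∞
  | one => 0
  | fin _ i => i
  | inf _ => ⊤

/-- The cycles of labels: those with the identity, and the triples above a triple of `R` whose
indices satisfy the thinning condition if its members lie in one block. -/
def Tri (R : α → α → α → Prop) (c : α → κ) (p q r : Label α κ) : Prop :=
  (p = one ∧ q = r) ∨ (q = one ∧ p = r) ∨ (r = one ∧ p = q) ∨
    ∃ x ∈ p.under c, ∃ y ∈ q.under c, ∃ z ∈ r.under c, R x y z ∧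
      (c x = c y → c y = c z → TwiceMax p.idx q.idx r.idx)

theorem Tri.swap_left (hc : IsCover R c) {p q r : Label α κ} (h : Tri R c p q r) :
    Tri R c q p r := by
  rcases h with h | h | ⟨h1, h2⟩ | ⟨x, hx, y, hy, z, hz, h1, h2⟩
  · exact Or.inr (Or.inl h)
  · exact Or.inl h
  · exact Or.inr (Or.inr (Or.inl ⟨h1, h2.symm⟩))
  · exact Or.inr (Or.inr (Or.inr ⟨y, hy, x, hx, z, hz, hc.swap_left h1,
      fun h3 h4 => (h2 h3.symm (h3.trans h4)).swap_left⟩))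

theorem Tri.swap_right (hc : IsCover R c) {p q r : Label α κ} (h : Tri R c p q r) :
    Tri R c p r q := by
  rcases h with ⟨h1, h2⟩ | h | h | ⟨x, hx, y, hy, z, hz, h1, h2⟩
  · exact Or.inl ⟨h1, h2.symm⟩
  · exact Or.inr (Or.inr (Or.inl h))
  · exact Or.inr (Or.inl h)
  · exact Or.inr (Or.inr (Or.inr ⟨x, hx, z, hz, y, hy, hc.swap_right h1,
      fun h3 h4 => (h2 (h3.trans h4) h4.symm).swap_right⟩))

theorem tri_one_left {q r : Label α κ} : Tri R c one q r ↔ q = r := by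
  constructor
  · rintro (h | h | h | ⟨x, hx, -⟩)
    · exact h.2
    · exact h.1.trans h.2
    · exact h.2.symm.trans h.1.symm
    · exact hx.elim
  · exact fun h => Or.inl ⟨rfl, h⟩

theorem tri_one_right (hc : IsCover R c) {p q : Label α κ} : Tri R c p q one ↔ p = q := by
  rw [← tri_one_left (R := R) (c := c) (q := p)]
  exact ⟨fun h => (h.swap_right hc).swap_left hc, fun h => (h.swap_left hc).swap_right hc⟩

/-- The block of a diversity label. -/
theorem exists_block (hc : IsCover R c) {q : Label α κ} (hq : q ≠ one) :
    ∃ d, (∃ x, x ∈ q.under c) ∧ ∀ x ∈ q.under c, c x = d := by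
  cases q with
  | one => exact absurd rfl hq
  | fin x i => exact ⟨c x, ⟨x, rfl⟩, by rintro _ rfl; rfl⟩
  | inf d => exact ⟨d, hc.surjective d, fun x hx => hx⟩

/-- Labels of which two belong to different blocks form a cycle as soon as their blocks do. -/
theorem tri_of_ne (hc : IsCover R c) {p q r : Label α κ} {x y z : α}
    (hp : ∃ a, a ∈ p.under c) (hq : ∃ a, a ∈ q.under c) (hr : ∃ a, a ∈ r.under c)
    (hx : ∀ a ∈ p.under c, c a = c x) (hy : ∀ a ∈ q.under c, c a = c y)
    (hz : ∀ a ∈ r.under c, c a = c z) (hne : c x ≠ c y) (h : R x y z) : Tri R c p q r := by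
  obtain ⟨x', hx'⟩ := hp
  obtain ⟨y', hy'⟩ := hq
  obtain ⟨z', hz'⟩ := hr
  refine Or.inr (Or.inr (Or.inr ⟨x', hx', y', hy', z', hz',
    hc.uniform h (fun h' => hne h'.1) (hx _ hx') (hy _ hy') (hz _ hz'), fun h' _ => ?_⟩))
  rw [hx _ hx', hy _ hy'] at h'
  exact absurd h' hne

/-- The labels form a flexible frame: the limit labels of the trio are flexible. -/
theorem isFlexibleFrame (hc : IsCover R c) {t : Fin 3 → κ} (ht : IsTrio R c t) :
    IsFlexibleFrame one (Tri R c) (Set.range fun i => inf (t i)) := by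
  -- each diversity label excludes at most one member of the trio
  have key : ∀ x : Label α κ, x ≠ one → ∃ i, ∀ j, j ≠ i → ∀ q, q ≠ one →
      Tri R c (inf (t j)) x q := by
    intro x hx
    obtain ⟨d, hd, hd'⟩ := exists_block hc hx
    have main : ∀ j, t j ≠ d → (∀ e, ∃ x y z, c x = d ∧ c y = t j ∧ c z = e ∧ R x y z) →
        ∀ q, q ≠ one → Tri R c (inf (t j)) x q := by
      intro j hj h q hq
      obtain ⟨e, he, he'⟩ := exists_block hc hq
      obtain ⟨x', y', z', rfl, hy', rfl, hR⟩ := h e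
      exact tri_of_ne hc (hc.surjective _) hd he (fun a ha => ha.trans hy'.symm) hd' he'
        (hy' ▸ hj) (hc.swap_left hR)
    by_cases hdt : ∃ i, t i = d
    · obtain ⟨i, rfl⟩ := hdt
      exact ⟨i, fun j hj => main j (fun h => hj (ht.injective h)) (fun e => ht.pair i j e)⟩
    · obtain ⟨i, hi⟩ := ht.other d
      exact ⟨i, fun j hj => main j (fun h => hdt ⟨j, h⟩) (hi j hj)⟩
  refine ⟨fun h => h.swap_left hc, fun h => h.swap_right hc, tri_one_left, ⟨_, 0, rfl⟩, ?_, ?_, ?_⟩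
  · rintro _ ⟨i, rfl⟩
    simp
  · rintro _ _ q ⟨i, rfl⟩ ⟨j, rfl⟩ hq
    obtain ⟨e, ⟨z', hz'⟩, he'⟩ := exists_block hc hq
    obtain ⟨x, y, z, hx, hy, hz, hR⟩ := ht.pair i j e
    have hmax : TwiceMax (⊤ : ℕ∞) ⊤ q.idx := Or.inr (Or.inr ⟨le_top, rfl⟩)
    by_cases h : c x = c y ∧ c y = c z
    · obtain ⟨x', hx', h'⟩ := hc.extend hR h.1 h.2 (y' := y) (z' := z') h.1.symm
        ((he' _ hz').trans (hz.symm.trans (h.1.trans h.2).symm))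
      exact Or.inr (Or.inr (Or.inr ⟨x', hx'.trans hx, y, hy, z', hz', h', fun _ _ => hmax⟩))
    · exact Or.inr (Or.inr (Or.inr ⟨x, hx, y, hy, z', hz', hc.uniform hR h rfl rfl
        ((he' _ hz').trans hz.symm), fun _ _ => hmax⟩))
  · rintro x y hx hy
    obtain ⟨i, hi⟩ := key x hx
    obtain ⟨j, hj⟩ := key y hy
    obtain ⟨k, hk⟩ : ∃ k : Fin 3, k ≠ i ∧ k ≠ j := by
      clear hi hj
      decide +revert
    exact ⟨_, ⟨k, rfl⟩, fun q hq => ⟨hi k hk.1 q hq, hj k hk.2 q hq⟩⟩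

/-- Labels whose index is less than `n` or infinite. -/
def IsBelow (n : ℕ) : Label α κ → Prop
  | fin _ i => i < n
  | _ => True

/-- Labels other than the limit labels. -/
def IsFine : Label α κ → Prop
  | inf _ => False
  | _ => True

/-- Replacing copies with index at least `n` by limits. -/
def collapse (c : α → κ) (n : ℕ) : Label α κ → Label α κ
  | one => one
  | fin x i => if i < n then fin x i else inf (c x)
  | inf d => inf d

theorem isBelow_collapse (n : ℕ) (q : Label α κ) : (q.collapse c n).IsBelow n := by
  cases q with
  | one => trivial
  | fin x i =>
    simp only [collapse]
    split_ifs with h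
    · exact h
    · trivial
  | inf d => trivial

theorem collapse_of_isBelow {n : ℕ} {q : Label α κ} (hq : q.IsBelow n) : q.collapse c n = q := by
  cases q with
  | one => rfl
  | fin x i => exact if_pos hq
  | inf d => rfl

theorem eventually_isBelow (q : Label α κ) : ∀ᶠ n in Filter.atTop, q.IsBelow n := by
  cases q with
  | one => exact Filter.Eventually.of_forall fun _ => trivial
  | fin x i => exact Filter.eventually_gt_atTop i
  | inf d => exact Filter.Eventually.of_forall fun _ => trivial

theorem collapse_eq_one {n : ℕ} {q : Label α κ} : q.collapse c n = one ↔ q = one := by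
  cases q with
  | one => simp [collapse]
  | fin x i =>
    simp only [collapse]
    split_ifs <;> simp
  | inf d => simp [collapse]

theorem under_subset_collapse (n : ℕ) (q : Label α κ) :
    q.under c ⊆ (q.collapse c n).under c := by
  cases q with
  | one => exact subset_rfl
  | fin x i =>
    simp only [collapse]
    split_ifs
    · exact subset_rfl
    · rintro _ rfl
      rfl
  | inf d => exact subset_rfl

theorem collapse_collapse {n m : ℕ} (h : n ≤ m) (q : Label α κ) :
    (q.collapse c m).collapse c n = q.collapse c n := by
  cases q with
  | one => rfl
  | fin x i =>
    by_cases h1 : i < m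
    · simp [collapse, h1]
    · simp [collapse, h1, show ¬ i < n by omega]
  | inf d => rfl

theorem tri_collapse (n : ℕ) {p q r : Label α κ} (h : Tri R c p q r) :
    Tri R c (p.collapse c n) (q.collapse c n) (r.collapse c n) := by
  classical
  rcases h with ⟨rfl, rfl⟩ | ⟨rfl, rfl⟩ | ⟨rfl, rfl⟩ | ⟨x, hx, y, hy, z, hz, h1, h2⟩
  · exact Or.inl ⟨rfl, rfl⟩
  · exact Or.inr (Or.inl ⟨rfl, rfl⟩)
  · exact Or.inr (Or.inr (Or.inl ⟨rfl, rfl⟩))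
  · refine Or.inr (Or.inr (Or.inr ⟨x, under_subset_collapse n p hx, y, under_subset_collapse n q hy,
      z, under_subset_collapse n r hz, h1, fun h3 h4 => ?_⟩))
    let f : ℕ∞ → ℕ∞ := fun i => if i < n then i else ⊤
    have hf : Monotone f := by
      intro i j hij
      simp only [f]
      split_ifs with h5 h6 h6
      · exact hij
      · exact le_top
      · exact absurd (hij.trans_lt h6) h5
      · exact le_rfl
    have hidx : ∀ {s : Label α κ} {a}, a ∈ s.under c → (s.collapse c n).idx = f s.idx := by
      intro s a ha
      cases s with
      | one => exact ha.elim
      | fin x i =>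
        simp only [f, idx, collapse, Nat.cast_lt]
        split_ifs <;> rfl
      | inf d => simp [f, idx, collapse]
    rw [hidx hx, hidx hy, hidx hz]
    exact (h2 h3 h4).map hf

/-- A fine label that collapses to a given one. -/
theorem exists_fine (hc : IsCover R c) {n : ℕ} {q : Label α κ} (hq : q.IsBelow n) :
    ∃ p : Label α κ, p.IsFine ∧ p.collapse c n = q := by
  cases q with
  | one => exact ⟨one, trivial, rfl⟩
  | fin x i => exact ⟨fin x i, trivial, if_pos hq⟩
  | inf d =>
    obtain ⟨x, rfl⟩ := hc.surjective d
    exact ⟨fin x n, trivial, by simp [collapse]⟩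

/-- The product of two classes of the equivalence "equal collapse" is a union of such classes. -/
theorem exists_fine_tri_iff (hc : IsCover R c) {n : ℕ} {q₁ q₂ r : Label α κ} (h₁ : q₁.IsBelow n)
    (h₂ : q₂.IsBelow n) (hr : r.IsFine) :
    (∃ p₁ p₂ : Label α κ, p₁.IsFine ∧ p₂.IsFine ∧ p₁.collapse c n = q₁ ∧ p₂.collapse c n = q₂ ∧
      Tri R c p₁ p₂ r) ↔ Tri R c q₁ q₂ (r.collapse c n) := by
  constructor
  · rintro ⟨p₁, p₂, -, -, rfl, rfl, h⟩
    exact tri_collapse n h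
  rintro (⟨rfl, rfl⟩ | ⟨rfl, rfl⟩ | ⟨h, rfl⟩ | ⟨x, hx, y, hy, z, hz, hR, hmax⟩)
  · exact ⟨one, r, trivial, hr, rfl, rfl, Or.inl ⟨rfl, rfl⟩⟩
  · exact ⟨r, one, hr, trivial, rfl, rfl, Or.inr (Or.inl ⟨rfl, rfl⟩)⟩
  · rw [collapse_eq_one] at h
    obtain ⟨p, hp, rfl⟩ := exists_fine hc h₁
    exact ⟨p, p, hp, hp, rfl, rfl, Or.inr (Or.inr (Or.inl ⟨h, rfl⟩))⟩
  obtain ⟨z₀, k, rfl⟩ : ∃ z₀ k, r = fin z₀ k := by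
    cases r with
    | one => exact hz.elim
    | fin z₀ k => exact ⟨z₀, k, rfl⟩
    | inf d => exact hr.elim
  have hcz : c z = c z₀ := by
    by_cases hk : k < n
    · simp only [collapse, hk, if_true] at hz
      rw [show z = z₀ from hz]
    · simp only [collapse, hk, if_false] at hz
      exact hz
  -- it is enough to find suitable elements and indices
  have hfin : ∀ x' y' i j, (fin x' i).collapse c n = q₁ → (fin y' j).collapse c n = q₂ →
      R x' y' z₀ → (c x' = c y' → c y' = c z₀ → TwiceMax i j k) →
      ∃ p₁ p₂ : Label α κ, p₁.IsFine ∧ p₂.IsFine ∧ p₁.collapse c n = q₁ ∧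
        p₂.collapse c n = q₂ ∧ Tri R c p₁ p₂ (fin z₀ k) := by
    intro x' y' i j h1 h2 h h'
    exact ⟨fin x' i, fin y' j, trivial, trivial, h1, h2,
      Or.inr (Or.inr (Or.inr ⟨x', rfl, y', rfl, z₀, rfl, h, fun h1 h2 =>
        (h' h1 h2).map (f := ((↑) : ℕ → ℕ∞)) Nat.mono_cast⟩))⟩
  by_cases hs : c x = c y ∧ c y = c z
  swap
  · have hidx : ∀ {q : Label α κ} {a}, a ∈ q.under c → q.IsBelow n →
        ∃ i, (fin a i).collapse c n = q := by
      intro q a ha hq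
      cases q with
      | one => exact ha.elim
      | fin b i => obtain rfl : a = b := ha; exact ⟨i, if_pos hq⟩
      | inf d => obtain rfl : c a = d := ha; exact ⟨n, if_neg (lt_irrefl n)⟩
    obtain ⟨i, hi⟩ := hidx hx h₁
    obtain ⟨j, hj⟩ := hidx hy h₂
    refine hfin x y i j hi hj (hc.uniform hR hs rfl rfl hcz.symm) fun h1 h2 => ?_
    exact absurd ⟨h1, h2.trans hcz.symm⟩ hs
  have hmax := hmax hs.1 hs.2
  have hcol : ∀ {a d i}, c a = d → n ≤ i → (fin a i).collapse c n = inf d := by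
    rintro a _ i rfl hi
    exact if_neg hi.not_gt
  by_cases hk : k < n
  · have hzz : (fin z₀ k).collapse c n = fin z₀ k := if_pos hk
    rw [hzz] at hmax hz
    obtain rfl : z = z₀ := hz
    cases q₁ with
    | one => exact hx.elim
    | fin x₁ i =>
      cases q₂ with
      | one => exact hy.elim
      | fin y₁ j =>
        exact ⟨fin x₁ i, fin y₁ j, trivial, trivial, if_pos h₁, if_pos h₂,
          Or.inr (Or.inr (Or.inr ⟨x, hx, y, hy, z, rfl, hR, fun _ _ => hmax⟩))⟩
      | inf d => simp [TwiceMax, idx] at hmax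
    | inf d =>
      cases q₂ with
      | one => exact hy.elim
      | fin y₁ j => simp [TwiceMax, idx] at hmax
      | inf d' =>
        exact hfin x y n n (hcol hx le_rfl) (hcol hy le_rfl) hR
          fun _ _ => Or.inr (Or.inr ⟨hk.le, rfl⟩)
  · have hk' : n ≤ k := not_lt.1 hk
    have hzz : (fin z₀ k).collapse c n = inf (c z₀) := if_neg hk
    rw [hzz] at hmax
    obtain ⟨x', hx', hRx⟩ := hc.extend hR hs.1 hs.2 (y' := y) (z' := z₀) hs.1.symm
      (hcz.symm.trans (hs.1.trans hs.2).symm)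
    cases q₁ with
    | one => exact hx.elim
    | fin x₁ i =>
      obtain rfl : x = x₁ := hx
      cases q₂ with
      | one => exact hy.elim
      | fin y₁ j => simp [TwiceMax, idx] at hmax
      | inf d =>
        obtain ⟨y', hy', hRy⟩ := hc.extend (hc.swap_left hR) hs.1.symm (hs.1.trans hs.2)
          (y' := x) (z' := z₀) hs.1 (hcz.symm.trans hs.2.symm)
        exact hfin x y' i k (if_pos h₁) (hcol (hy'.trans hy) hk') (hc.swap_left hRy)
          fun _ _ => Or.inl ⟨(lt_of_lt_of_le h₁ hk').le, rfl⟩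
    | inf d =>
      cases q₂ with
      | one => exact hy.elim
      | fin y₁ j =>
        obtain rfl : y = y₁ := hy
        exact hfin x' y k j (hcol (hx'.trans hx) hk') (if_pos h₂) hRx
          fun _ _ => Or.inr (Or.inl ⟨(lt_of_lt_of_le h₂ hk').le, rfl⟩)
      | inf d' =>
        exact hfin x' y k k (hcol (hx'.trans hx) hk') (hcol hy hk') hRx
          fun _ _ => Or.inr (Or.inr ⟨le_rfl, rfl⟩)

end Label

theorem IsFlexibleFrame.restrict {L : Type u} {one : L} {T : L → L → L → Prop} {F : Set L}
    (hF : IsFlexibleFrame one T F) {P : L → Prop} (h1 : P one) (hP : ∀ t ∈ F, P t) :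
    IsFlexibleFrame (⟨one, h1⟩ : {q // P q}) (fun p q r => T p.1 q.1 r.1) {q | q.1 ∈ F} where
  swap_left h := hF.swap_left h
  swap_right h := hF.swap_right h
  one_iff := hF.one_iff.trans Subtype.ext_iff.symm
  nonempty := by
    obtain ⟨t, ht⟩ := hF.nonempty
    exact ⟨⟨t, hP t ht⟩, ht⟩
  ne_one := fun ht h => hF.ne_one ht (congrArg Subtype.val h)
  pair := fun ht ht' hq => hF.pair ht ht' fun h => hq (Subtype.ext h)
  common := by
    intro x y hx hy
    obtain ⟨t, ht, h⟩ := hF.common (fun h => hx (Subtype.ext h)) (fun h => hy (Subtype.ext h))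
    exact ⟨⟨t, hP t ht⟩, ht, fun q hq => h q.1 fun h => hq (Subtype.ext h)⟩

/-! ### The levels of the split algebra -/

/-- The diversity atoms. -/
abbrev DivAt (A : Type u) [NonassocRelAlgebra A] : Type u := {x : A // IsDivAtom x}

/-- The diversity cycles of an algebra. -/
def DivCycle {A : Type u} [NonassocRelAlgebra A] (x y z : DivAt A) : Prop :=
  z.1 ≤ x.1 ⨾ y.1

/-- A cover of the diversity cycles of `A` whose blocks give the same thinning condition as the
atoms of `E`. -/
structure IsThinningCover {A : Type u} [NonassocRelAlgebra A] {κ : Type v} (E : Subalg A)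
    (c : DivAt A → κ) : Prop extends IsCover (DivCycle (A := A)) c where
  sameCover_iff : ∀ {x y z : DivAt A}, DivCycle x y z →
    (SameCover E x.1 y.1 z.1 ↔ c x = c y ∧ c y = c z)

namespace SplitAtom

variable {A : Type u} [NonassocRelAlgebra A] {κ : Type v} {E : Subalg A} {c : DivAt A → κ}

/-- The label of an atom. -/
def label (κ : Type v) : SplitAtom A → Label (DivAt A) κ
  | one => .one
  | copy x hx i => .fin ⟨x, hx⟩ i

theorem label_injective : Function.Injective (label κ : SplitAtom A → Label (DivAt A) κ) := by
  intro p q h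
  cases p <;> cases q <;> simp_all [label]

theorem isFine_label (p : SplitAtom A) : (p.label κ).IsFine := by
  cases p <;> trivial

theorem exists_label_eq {q : Label (DivAt A) κ} (hq : q.IsFine) :
    ∃ p : SplitAtom A, p.label κ = q := by
  cases q with
  | one => exact ⟨one, rfl⟩
  | fin x i => exact ⟨copy x.1 x.2 i, rfl⟩
  | inf d => exact hq.elim

theorem mem_cycles_iff (hc : IsThinningCover E c) {p q r : SplitAtom A} :
    (p, q, r) ∈ cycles E ↔ Label.Tri DivCycle c (p.label κ) (q.label κ) (r.label κ) := by
  have sl : ∀ {p q r : Label (DivAt A) κ}, Label.Tri DivCycle c p q r →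
    Label.Tri DivCycle c q p r := fun h => h.swap_left hc.toIsCover
  have sr : ∀ {p q r : Label (DivAt A) κ}, Label.Tri DivCycle c p q r →
    Label.Tri DivCycle c p r q := fun h => h.swap_right hc.toIsCover
  constructor
  · have main : ∀ {a b d : SplitAtom A}, (p, q, r) ∈ cycleSet a b d →
        Label.Tri DivCycle c (a.label κ) (b.label κ) (d.label κ) →
        Label.Tri DivCycle c (p.label κ) (q.label κ) (r.label κ) := by
      intro a b d h ht
      simp only [cycleSet, Set.mem_insert_iff, Set.mem_singleton_iff, Prod.mk.injEq] at h
      rcases h with ⟨rfl, rfl, rfl⟩ | ⟨rfl, rfl, rfl⟩ | ⟨rfl, rfl, rfl⟩ | ⟨rfl, rfl, rfl⟩ |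
        ⟨rfl, rfl, rfl⟩ | ⟨rfl, rfl, rfl⟩
      · exact ht
      · exact sr ht
      · exact sr (sl ht)
      · exact sl ht
      · exact sl (sr ht)
      · exact sl (sr (sl ht))
    rintro (h | ⟨x, hx, i, h⟩ | ⟨x, hx, i, y, hy, j, z, hz, k, hle, hthin, h⟩)
    · exact main h (Or.inl ⟨rfl, rfl⟩)
    · exact main h (Or.inl ⟨rfl, rfl⟩)
    · refine main h (Or.inr (Or.inr (Or.inr ⟨⟨x, hx⟩, rfl, ⟨y, hy⟩, rfl, ⟨z, hz⟩, rfl, hle, ?_⟩)))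
      intro h1 h2
      exact TwiceMax.map (f := ((↑) : ℕ → ℕ∞)) Nat.mono_cast
        (hthin ((hc.sameCover_iff (x := ⟨x, hx⟩) (y := ⟨y, hy⟩) (z := ⟨z, hz⟩) hle).2 ⟨h1, h2⟩))
  · rintro (⟨h1, h2⟩ | ⟨h1, h2⟩ | ⟨h1, h2⟩ | ⟨x, hx, y, hy, z, hz, h1, h2⟩)
    · obtain rfl : p = one := label_injective (κ := κ) h1
      obtain rfl := label_injective h2
      exact (SplitAlgebra.cycles_swap (SplitAlgebra.cycles_one.2 rfl)).1
    · obtain rfl : q = one := label_injective (κ := κ) h1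
      obtain rfl := label_injective h2
      exact SplitAlgebra.cycles_one.2 rfl
    · obtain rfl : r = one := label_injective (κ := κ) h1
      obtain rfl := label_injective h2
      exact (SplitAlgebra.cycles_swap (SplitAlgebra.cycles_one.2 rfl)).2
    · cases p with
      | one => exact hx.elim
      | copy x' hx' i =>
      cases q with
      | one => exact hy.elim
      | copy y' hy' j =>
      cases r with
      | one => exact hz.elim
      | copy z' hz' k =>
      obtain rfl : x = ⟨x', hx'⟩ := hx
      obtain rfl : y = ⟨y', hy'⟩ := hy
      obtain rfl : z = ⟨z', hz'⟩ := hz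
      refine Or.inr (Or.inr ⟨x', hx', i, y', hy', j, z', hz', k, h1, fun h => ?_, Or.inl rfl⟩)
      have h3 := (hc.sameCover_iff h1).1 h
      simpa [TwiceMax, Label.idx, label, Thin] using h2 h3.1 h3.2

theorem copy_mem_cycles_iff (hc : IsThinningCover E c) {x y z : DivAt A} {i j k : ℕ} :
    (copy x.1 x.2 i, copy y.1 y.2 j, copy z.1 z.2 k) ∈ cycles E ↔
      DivCycle x y z ∧ (c x = c y → c y = c z → Thin i j k) := by
  rw [mem_cycles_iff hc]
  simp [label, Label.Tri, Label.under, Label.idx, TwiceMax, Thin]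

instance [Finite A] : Countable (SplitAtom A) :=
  (label_injective (A := A) (κ := PUnit.{1})).countable

end SplitAtom

namespace SplitAlgebra

variable {A : Type u} [NonassocRelAlgebra A] {κ : Type v} {E : Subalg A} {c : DivAt A → κ}

instance : Membership (SplitAtom A) (SplitAlgebra E) :=
  inferInstanceAs (Membership (SplitAtom A) (Set (SplitAtom A)))

/-- The element whose atoms satisfy `P`. -/
def ofPred (E : Subalg A) (P : SplitAtom A → Prop) : SplitAlgebra E :=
  ({p | P p} : Set (SplitAtom A))

theorem mem_ofPred {P : SplitAtom A → Prop} {p : SplitAtom A} : p ∈ ofPred E P ↔ P p := Iff.rfl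

theorem mem_sup {X Y : SplitAlgebra E} {p : SplitAtom A} : p ∈ X ⊔ Y ↔ p ∈ X ∨ p ∈ Y := Iff.rfl

theorem mem_compl {X : SplitAlgebra E} {p : SplitAtom A} : p ∈ Xᶜ ↔ p ∉ X := Iff.rfl

theorem mem_top {p : SplitAtom A} : p ∈ (⊤ : SplitAlgebra E) := trivial

theorem ext {X Y : SplitAlgebra E} (h : ∀ p, p ∈ X ↔ p ∈ Y) : X = Y := Set.ext h

theorem exists_mem_of_ne_bot {X : SplitAlgebra E} (h : X ≠ ⊥) : ∃ p, p ∈ X :=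
  Set.nonempty_iff_ne_empty.2 h

theorem isAtom_iff {X : SplitAlgebra E} : IsAtom X ↔ ∃ p, X = ofPred E (· = p) :=
  Set.isAtom_iff

/-- The subalgebra of the unions of classes of atoms with equal `n`-th collapse. -/
def level (hc : IsThinningCover E c) (n : ℕ) : Subalg (SplitAlgebra E) where
  carrier := {X | ∀ p q : SplitAtom A, (p.label κ).collapse c n = (q.label κ).collapse c n →
    p ∈ X → q ∈ X}
  supClosed' := fun _ hX _ hY p q h => Or.imp (hX p q h) (hY p q h)
  infClosed' := fun _ hX _ hY p q h => And.imp (hX p q h) (hY p q h)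
  compl_mem' := fun hX p q h hp hq => hp (hX q p h.symm hq)
  bot_mem' := fun _ _ _ h => h
  comp_mem' := by
    rintro X Y hX hY r r' h ⟨p, hp, q, hq, hpq⟩
    rw [SplitAtom.mem_cycles_iff hc] at hpq
    have h1 := Label.tri_collapse n hpq
    rw [h, ← Label.exists_fine_tri_iff hc.toIsCover (Label.isBelow_collapse n _)
      (Label.isBelow_collapse n _) (SplitAtom.isFine_label r')] at h1
    obtain ⟨p', q', hp', hq', hpp, hqq, h2⟩ := h1
    obtain ⟨p', rfl⟩ := SplitAtom.exists_label_eq hp'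
    obtain ⟨q', rfl⟩ := SplitAtom.exists_label_eq hq'
    exact ⟨p', hX _ _ hpp.symm hp, q', hY _ _ hqq.symm hq, (SplitAtom.mem_cycles_iff hc).2 h2⟩
  conv_mem' := fun h => h
  ide_mem' := by
    rintro p q h rfl
    have h1 : (q.label κ).collapse c n = .one := h.symm
    rw [Label.collapse_eq_one] at h1
    exact SplitAtom.label_injective (κ := κ) h1

theorem level_mono (hc : IsThinningCover E c) {n m : ℕ} (h : n ≤ m) {X : SplitAlgebra E}
    (hX : X ∈ level hc n) : X ∈ level hc m := by
  intro p q hpq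
  refine hX p q ?_
  rw [← Label.collapse_collapse h, hpq, Label.collapse_collapse h]

/-- The class of the atoms with the given collapse. -/
def fiber (E : Subalg A) (c : DivAt A → κ) (n : ℕ) (q : Label (DivAt A) κ) : SplitAlgebra E :=
  ofPred E fun p => (p.label κ).collapse c n = q

theorem fiber_mem_level (hc : IsThinningCover E c) (n : ℕ) (q : Label (DivAt A) κ) :
    fiber E c n q ∈ level hc n :=
  fun _ _ h hp => h.symm.trans hp

theorem exists_mem_fiber (hc : IsThinningCover E c) {n : ℕ} {q : Label (DivAt A) κ}
    (hq : q.IsBelow n) : ∃ p, p ∈ fiber E c n q := by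
  obtain ⟨p, hp, h⟩ := Label.exists_fine hc.toIsCover hq
  obtain ⟨p, rfl⟩ := SplitAtom.exists_label_eq hp
  exact ⟨p, h⟩

theorem fiber_le_comp_iff (hc : IsThinningCover E c) {n : ℕ} {p q r : Label (DivAt A) κ}
    (hp : p.IsBelow n) (hq : q.IsBelow n) (hr : r.IsBelow n) :
    fiber E c n r ≤ fiber E c n p ⨾ fiber E c n q ↔ Label.Tri DivCycle c p q r := by
  have key : ∀ s, s ∈ fiber E c n r → (s ∈ fiber E c n p ⨾ fiber E c n q ↔
      Label.Tri DivCycle c p q r) := by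
    intro s hs
    obtain rfl : (s.label κ).collapse c n = r := hs
    rw [← Label.exists_fine_tri_iff hc.toIsCover hp hq (SplitAtom.isFine_label s)]
    constructor
    · rintro ⟨p', hp', q', hq', h⟩
      exact ⟨_, _, SplitAtom.isFine_label p', SplitAtom.isFine_label q', hp', hq',
        (SplitAtom.mem_cycles_iff hc).1 h⟩
    · rintro ⟨p', q', hp', hq', hpp, hqq, h⟩
      obtain ⟨p', rfl⟩ := SplitAtom.exists_label_eq hp'
      obtain ⟨q', rfl⟩ := SplitAtom.exists_label_eq hq'
      exact ⟨p', hpp, q', hqq, (SplitAtom.mem_cycles_iff hc).2 h⟩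
  obtain ⟨s, hs⟩ := exists_mem_fiber (E := E) hc hr
  exact ⟨fun h => (key s hs).1 (h hs), fun h s' hs' => (key s' hs').2 h⟩

/-- An algebra isomorphic to a level of the split algebra has the 1-point extension property. -/
theorem hasOnePointExtension_of_level (hc : IsThinningCover E c) {t : Fin 3 → κ}
    (ht : IsTrio (DivCycle (A := A)) c t) (n : ℕ) {α : Type w} [NonassocRelAlgebra α]
    (ψ : α → SplitAlgebra E) (hle : ∀ a b, ψ a ≤ ψ b ↔ a ≤ b)
    (hcomp : ∀ a b, ψ (a ⨾ b) = ψ a ⨾ ψ b) (hconv : ∀ a, ψ (conv a) = conv (ψ a))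
    (hide : ψ ide = ide) (hrange : ∀ X, X ∈ level hc n ↔ ∃ a, ψ a = X) :
    HasOnePointExtension α := by
  have hinj : Function.Injective ψ := fun a b h =>
    le_antisymm ((hle a b).1 h.le) ((hle b a).1 h.ge)
  have hbot : ψ ⊥ = ⊥ := by
    obtain ⟨a, ha⟩ := (hrange ⊥).1 (level hc n).bot_mem'
    exact le_bot_iff.1 (ha ▸ (hle ⊥ a).2 bot_le)
  choose φ hφ using fun q => (hrange _).1 (fiber_mem_level hc n q)
  have hmem : ∀ a p, p ∈ ψ a → φ ((p.label κ).collapse c n) ≤ a := by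
    intro a p hp
    rw [← hle, hφ]
    intro s hs
    exact (hrange _).2 ⟨a, rfl⟩ p s (Eq.symm hs) hp
  have hatom : ∀ q : Label (DivAt A) κ, q.IsBelow n → IsAtom (φ q) := by
    intro q hq
    refine ⟨fun h => ?_, fun b hb => ?_⟩
    · obtain ⟨p, hp⟩ := exists_mem_fiber (E := E) hc hq
      rw [← hφ, h, hbot] at hp
      exact hp
    · by_contra h
      obtain ⟨p, hp⟩ := exists_mem_of_ne_bot (X := ψ b) fun h' => h (hinj (h'.trans hbot.symm))
      have h1 := (hle _ _).2 hb.le hp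
      rw [hφ] at h1
      have h2 := hmem b p hp
      rw [show (p.label κ).collapse c n = q from h1] at h2
      exact hb.not_ge h2
  have hex : ∀ a : α, a ≠ ⊥ → ∃ q : Label (DivAt A) κ, q.IsBelow n ∧ φ q ≤ a := by
    intro a ha
    obtain ⟨p, hp⟩ := exists_mem_of_ne_bot (X := ψ a) fun h' => ha (hinj (h'.trans hbot.symm))
    exact ⟨_, Label.isBelow_collapse n _, hmem a p hp⟩
  have hat : IsAtomic α := by
    refine ⟨fun a => or_iff_not_imp_left.2 fun ha => ?_⟩
    obtain ⟨q, hq, h⟩ := hex a ha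
    exact ⟨_, hatom q hq, h⟩
  have hF := (Label.isFlexibleFrame hc.toIsCover ht).restrict (P := fun q => q.IsBelow n) trivial
    (by rintro _ ⟨i, rfl⟩; trivial)
  refine hF.hasOnePointExtension (fun a => hinj (hconv a)) (fun q => φ q.1) ?_ ?_ ?_ ?_
  · intro p q h
    obtain ⟨s, hs⟩ := exists_mem_fiber (E := E) hc p.2
    have h1 : fiber E c n p.1 = fiber E c n q.1 := by
      rw [← hφ, ← hφ]
      exact congrArg ψ h
    have h2 := hs
    rw [h1] at h2
    exact Subtype.ext (Eq.trans (Eq.symm hs) h2)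
  · intro a
    constructor
    · intro ha
      obtain ⟨q, hq, h⟩ := hex a ha.1
      exact ⟨⟨q, hq⟩, (ha.le_iff.1 h).resolve_left (hatom q hq).1⟩
    · rintro ⟨q, rfl⟩
      exact hatom q.1 q.2
  · apply hinj
    rw [hφ, hide]
    refine ext fun p => ?_
    exact Label.collapse_eq_one.trans ((SplitAtom.label_injective (κ := κ)).eq_iff' rfl)
  · intro p q r
    rw [← hle, hcomp, hφ, hφ, hφ]
    exact fiber_le_comp_iff hc p.2 q.2 r.2

/-! ### The representation -/

/-- The labels near which `X` has atoms: for all large `m` some atom of `X` collapses to the label.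
If `X` belongs to a level, then for all large `m` every atom collapsing to the label is in `X`. -/
def hat (c : DivAt A → κ) (X : SplitAlgebra E) : Set (Label (DivAt A) κ) :=
  {q | ∀ᶠ m in Filter.atTop, ∃ p ∈ X, (p.label κ).collapse c m = q}

theorem mem_hat_iff (hc : IsThinningCover E c) {m : ℕ} {X : SplitAlgebra E}
    (hX : X ∈ level hc m) {q : Label (DivAt A) κ} (hq : q.IsBelow m) {p : SplitAtom A}
    (hp : (p.label κ).collapse c m = q) : q ∈ hat c X ↔ p ∈ X := by
  have key : ∀ m' ≥ m, (∃ p' ∈ X, (p'.label κ).collapse c m' = q) ↔ p ∈ X := by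
    intro m' hm
    constructor
    · rintro ⟨p', hp', rfl⟩
      refine hX p' p ?_ hp'
      rw [hp, ← Label.collapse_collapse hm, Label.collapse_of_isBelow hq]
    · intro hpX
      have hq' : q.IsBelow m' := by
        rw [← hp]
        cases p with
        | one => trivial
        | copy x hx i =>
          simp only [SplitAtom.label, Label.collapse]
          split_ifs with h
          · exact h.trans_le hm
          · trivial
      obtain ⟨p', hp'⟩ := exists_mem_fiber (E := E) hc hq'
      obtain rfl : (p'.label κ).collapse c m' = q := hp'
      refine ⟨p', hX p p' ?_ hpX, rfl⟩
      rw [hp, ← Label.collapse_collapse hm, Label.collapse_of_isBelow hq]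
  constructor
  · intro h
    obtain ⟨m', h1, h2⟩ := (h.and (Filter.eventually_ge_atTop m)).exists
    exact (key m' h2).1 h1
  · intro h
    exact (Filter.eventually_ge_atTop m).mono fun m' hm => (key m' hm).2 h

theorem eventually_mem_hat_iff (hc : IsThinningCover E c) {X : SplitAlgebra E}
    (hX : ∃ n, X ∈ level hc n) (q : Label (DivAt A) κ) :
    ∀ᶠ m in Filter.atTop, X ∈ level hc m ∧ q.IsBelow m ∧
      ∀ p : SplitAtom A, (p.label κ).collapse c m = q → (q ∈ hat c X ↔ p ∈ X) := by
  obtain ⟨n, hX⟩ := hX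
  filter_upwards [Filter.eventually_ge_atTop n, Label.eventually_isBelow q] with m hm hq
  exact ⟨level_mono hc hm hX, hq, fun p hp => mem_hat_iff hc (level_mono hc hm hX) hq hp⟩

theorem mem_hat_comp (hc : IsThinningCover E c) {X Y : SplitAlgebra E}
    (hX : ∃ n, X ∈ level hc n) (hY : ∃ n, Y ∈ level hc n) {r : Label (DivAt A) κ} :
    r ∈ hat c (X ⨾ Y) ↔ ∃ p ∈ hat c X, ∃ q ∈ hat c Y, Label.Tri DivCycle c p q r := by
  have hXY : ∃ n, X ⨾ Y ∈ level hc n := by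
    obtain ⟨n, hn⟩ := hX
    obtain ⟨m, hm⟩ := hY
    exact ⟨max n m, (level hc _).comp_mem' (level_mono hc (le_max_left n m) hn)
      (level_mono hc (le_max_right n m) hm)⟩
  have hr := eventually_mem_hat_iff hc hXY r
  constructor
  · intro h
    obtain ⟨m, ⟨-, hrm, hr⟩, ⟨hXm, -⟩, ⟨hYm, -⟩⟩ := (hr.and
      ((eventually_mem_hat_iff hc hX r).and (eventually_mem_hat_iff hc hY r))).exists
    obtain ⟨s, hs⟩ := exists_mem_fiber (E := E) hc hrm
    obtain ⟨p, hp, q, hq, hpq⟩ := (hr s hs).1 h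
    rw [SplitAtom.mem_cycles_iff hc] at hpq
    have h2 := Label.tri_collapse m hpq
    rw [show (s.label κ).collapse c m = r from hs] at h2
    exact ⟨_, (mem_hat_iff hc hXm (Label.isBelow_collapse m _) rfl).2 hp, _,
      (mem_hat_iff hc hYm (Label.isBelow_collapse m _) rfl).2 hq, h2⟩
  · rintro ⟨p, hp, q, hq, hpq⟩
    obtain ⟨m, ⟨-, hrm, hr⟩, ⟨-, hpm, hpX⟩, ⟨-, hqm, hqY⟩⟩ := (hr.and
      ((eventually_mem_hat_iff hc hX p).and (eventually_mem_hat_iff hc hY q))).exists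
    obtain ⟨s, hs⟩ := exists_mem_fiber (E := E) hc hrm
    rw [← show (s.label κ).collapse c m = r from hs, ← Label.exists_fine_tri_iff hc.toIsCover hpm
      hqm (SplitAtom.isFine_label s)] at hpq
    obtain ⟨p', q', hp', hq', hpp, hqq, h⟩ := hpq
    obtain ⟨p', rfl⟩ := SplitAtom.exists_label_eq hp'
    obtain ⟨q', rfl⟩ := SplitAtom.exists_label_eq hq'
    exact (hr s hs).2 ⟨p', (hpX p' hpp).1 hp, q', (hqY q' hqq).1 hq,
      (SplitAtom.mem_cycles_iff hc).2 h⟩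

theorem label_mem_hat_iff (hc : IsThinningCover E c) {X : SplitAlgebra E}
    (hX : ∃ n, X ∈ level hc n) (p : SplitAtom A) : p.label κ ∈ hat c X ↔ p ∈ X := by
  obtain ⟨m, -, h1, h2⟩ := (eventually_mem_hat_iff hc hX (p.label κ)).exists
  exact h2 p (Label.collapse_of_isBelow h1)

/-- The points are natural numbers, and an element relates the pairs whose label in a saturated
network belongs to it. -/
theorem isRepresentable (hc : IsThinningCover E c) [Finite A] [Countable κ] {t : Fin 3 → κ}
    (ht : IsTrio (DivCycle (A := A)) c t) (B : Subalg (SplitAlgebra E))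
    (hB : ∀ X ∈ B, ∃ n, X ∈ level hc n) : IsRepresentable.{u, w} B := by
  have hF := Label.isFlexibleFrame hc.toIsCover ht
  obtain ⟨N, hN, hsat⟩ := hF.exists_saturated
  have hone : ∀ i j, N i j = .one ↔ i = j := fun i j =>
    hN.eq_one_iff (Set.mem_univ i) (Set.mem_univ j)
  -- saturation extends to the loops
  have hsat' : ∀ i j x y, Label.Tri DivCycle c x y (N i j) → ∃ k, N i k = x ∧ N k j = y := by
    intro i j x y h
    by_cases hx : x = .one
    · subst hx
      exact ⟨i, (hone i i).2 rfl, ((hF.one_iff).1 h).symm⟩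
    by_cases hy : y = .one
    · subst hy
      exact ⟨j, ((hF.one_iff).1 (hF.swap_left h)).symm, (hone j j).2 rfl⟩
    by_cases hij : i = j
    · subst hij
      rw [(hone i i).2 rfl, Label.tri_one_right hc.toIsCover] at h
      subst h
      have hne : i ≠ i + 1 := by omega
      obtain ⟨y, hy, h⟩ := hF.exists_factor hx (fun h => hne ((hone _ _).1 h))
      obtain ⟨k, hk, -⟩ := hsat i (i + 1) x y hne hx hy h
      exact ⟨k, hk, (hN.symm (Set.mem_univ k) (Set.mem_univ i)).trans hk⟩
    · exact hsat i j x y hij hx hy h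
  have hrealized : ∀ x, ∃ i j, N i j = x := by
    intro x
    by_cases hx : x = .one
    · exact ⟨0, 0, hx ▸ (hone 0 0).2 rfl⟩
    · obtain ⟨k, hk, -⟩ := hsat' 0 0 x x (by
        rw [(hone 0 0).2 rfl]
        exact hF.one_right x)
      exact ⟨0, k, hk⟩
  have hfib : ∀ {m : ℕ} {q : Label (DivAt A) κ}, q.IsBelow m →
      ∃ p : SplitAtom A, (p.label κ).collapse c m = q := fun hq => exists_mem_fiber (E := E) hc hq
  refine ⟨ULift.{w} ℕ, fun X => {e | N e.1.down e.2.down ∈ hat c X.1}, ⟨?_, ?_, ?_, ?_, ?_, ?_⟩⟩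
  · intro X Y h
    refine Subtype.ext (ext fun p => ?_)
    obtain ⟨i, j, hij⟩ := hrealized (p.label κ)
    have h1 := Set.ext_iff.1 h (⟨i⟩, ⟨j⟩)
    simp only [Set.mem_ofPred_eq, hij] at h1
    rwa [label_mem_hat_iff hc (hB _ X.2), label_mem_hat_iff hc (hB _ Y.2)] at h1
  · intro X Y
    ext ⟨⟨i⟩, ⟨j⟩⟩
    obtain ⟨m, ⟨-, hq, h1⟩, ⟨-, -, h2⟩, ⟨-, -, h3⟩⟩ :=
      ((eventually_mem_hat_iff hc (hB _ X.2) (N i j)).and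
      ((eventually_mem_hat_iff hc (hB _ Y.2) (N i j)).and
      (eventually_mem_hat_iff hc (hB _ (X ⊔ Y).2) (N i j)))).exists
    obtain ⟨p, hp⟩ := hfib hq
    exact (h3 p hp).trans (or_congr (h1 p hp) (h2 p hp)).symm
  · intro X
    ext ⟨⟨i⟩, ⟨j⟩⟩
    obtain ⟨m, ⟨-, hq, h1⟩, ⟨-, -, h2⟩, ⟨-, -, h3⟩⟩ :=
      ((eventually_mem_hat_iff hc (hB _ X.2) (N i j)).and
      ((eventually_mem_hat_iff hc (hB _ Xᶜ.2) (N i j)).and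
      (eventually_mem_hat_iff hc (hB _ (⊤ : B).2) (N i j)))).exists
    obtain ⟨p, hp⟩ := hfib hq
    have h4 : N i j ∈ hat c (⊤ : B).1 := (h3 p hp).2 mem_top
    refine (h2 p hp).trans ⟨fun h => ⟨h4, fun h' => h ((h1 p hp).1 h')⟩, fun h h' => ?_⟩
    exact h.2 ((h1 p hp).2 h')
  · intro X Y
    ext ⟨⟨i⟩, ⟨j⟩⟩
    refine (mem_hat_comp hc (hB _ X.2) (hB _ Y.2)).trans ⟨?_, ?_⟩
    · rintro ⟨p, hp, q, hq, h⟩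
      obtain ⟨k, rfl, rfl⟩ := hsat' i j p q h
      exact ⟨⟨k⟩, hp, hq⟩
    · rintro ⟨⟨k⟩, hp, hq⟩
      exact ⟨_, hp, _, hq, hN.tri (Set.mem_univ _) (Set.mem_univ _) (Set.mem_univ _)⟩
  · intro X
    ext ⟨⟨i⟩, ⟨j⟩⟩
    change N i j ∈ hat c X.1 ↔ N j i ∈ hat c X.1
    rw [hN.symm (Set.mem_univ i) (Set.mem_univ j)]
  · ext ⟨⟨i⟩, ⟨j⟩⟩
    obtain ⟨m, -, hq, h1⟩ := (eventually_mem_hat_iff hc (hB _ (ide : B).2) (N i j)).exists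
    obtain ⟨p, hp⟩ := hfib hq
    refine (h1 p hp).trans (Iff.trans ?_ ULift.up_inj.symm)
    refine Iff.trans ?_ (hone i j)
    rw [← hp, Label.collapse_eq_one]
    exact ((SplitAtom.label_injective (κ := κ)).eq_iff' rfl).symm

end SplitAlgebra

/-! ### The cover given by a subalgebra -/

section SubalgebraCover

variable {A : Type u} [NonassocRelAlgebra A] {E : Subalg A}

theorem eq_of_isAtom_of_le {x : A} (hx : IsAtom x) {a b : E} (ha : IsAtom a) (hb : IsAtom b)
    (hxa : x ≤ a) (hxb : x ≤ b) : a = b := by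
  by_contra h
  have h1 : a ⊓ b ≤ ⊥ := (ha.disjoint_of_ne hb h).le_bot
  exact hx.1 (le_bot_iff.1 ((le_inf hxa hxb).trans h1))

variable [Finite A]

theorem exists_divAtom_ge (E : Subalg A) (x : DivAt A) :
    ∃ a : {a : E // IsDivAtom a}, x.1 ≤ (a.1 : A) := by
  obtain ⟨m, hm, hmin⟩ := WellFounded.has_min (wellFounded_lt (α := E)) {e : E | x.1 ≤ (e : A)}
    ⟨⊤, show x.1 ≤ (⊤ : A) from le_top⟩
  have key : ∀ e : E, x.1 ≤ (e : A) → m ≤ e := by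
    intro e he
    by_contra h
    exact hmin (m ⊓ e) (show x.1 ≤ (m : A) ⊓ (e : A) from le_inf hm he) (inf_lt_left.2 h)
  refine ⟨⟨m, ⟨?_, fun e he => ?_⟩, key ideᶜ x.2.2⟩, hm⟩
  · rintro rfl
    exact x.2.1.1 (le_bot_iff.1 hm)
  · have h1 : ¬ x.1 ≤ (e : A) := fun h => he.not_ge (key e h)
    have h2 : x.1 ≤ ((eᶜ : E) : A) :=
      le_compl_iff_disjoint_right.2 (x.2.1.not_le_iff_disjoint.1 h1)
    exact le_compl_self.1 (he.le.trans (key _ h2))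

/-- The atom of `E` above a diversity atom of `A`. -/
noncomputable def coverAtom (E : Subalg A) (x : DivAt A) : {a : E // IsDivAtom a} :=
  (exists_divAtom_ge E x).choose

theorem le_coverAtom (E : Subalg A) (x : DivAt A) : x.1 ≤ ((coverAtom E x).1 : A) :=
  (exists_divAtom_ge E x).choose_spec

theorem coverAtom_eq_iff {x : DivAt A} {a : {a : E // IsDivAtom a}} :
    coverAtom E x = a ↔ x.1 ≤ (a.1 : A) := by
  refine ⟨fun h => h ▸ le_coverAtom E x, fun h => Subtype.ext ?_⟩
  exact eq_of_isAtom_of_le x.2.1 (coverAtom E x).2.1 a.2.1 (le_coverAtom E x) h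

theorem exists_coverAtom_eq (a : {a : E // IsDivAtom a}) {y : A} (hy : IsAtom y)
    (h : y ≤ (a.1 : A)) : ∃ x : DivAt A, x.1 = y ∧ coverAtom E x = a :=
  ⟨⟨y, hy, h.trans (show a.1 ≤ ideᶜ from a.2.2)⟩, rfl, coverAtom_eq_iff.2 h⟩

theorem coverAtom_le_comp {x y z : DivAt A} (h : DivCycle x y z) :
    (coverAtom E z).1 ≤ (coverAtom E x).1 ⨾ (coverAtom E y).1 := by
  refine (coverAtom E z).2.1.not_disjoint_iff_le.1 fun hd => ?_
  have h1 : z.1 ≤ ((coverAtom E x).1 : A) ⨾ ((coverAtom E y).1 : A) :=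
    h.trans (comp_mono (le_coverAtom E x) (le_coverAtom E y))
  have h2 : (coverAtom E z).1 ⊓ ((coverAtom E x).1 ⨾ (coverAtom E y).1) ≤ ⊥ := hd.le_bot
  exact z.2.1.1 (le_bot_iff.1 ((le_inf (le_coverAtom E z) h1).trans h2))

theorem exists_divCycle {a b d : {a : E // IsDivAtom a}} (h : d.1 ≤ a.1 ⨾ b.1) :
    ∃ x y z : DivAt A, coverAtom E x = a ∧ coverAtom E y = b ∧ coverAtom E z = d ∧
      DivCycle x y z := by
  obtain ⟨z, hz, hzd⟩ := (IsAtomic.eq_bot_or_exists_atom_le (d.1 : A)).resolve_left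
    fun h0 => d.2.1.1 (Subtype.ext h0)
  obtain ⟨x, y, hx, hy, hxa, hyb, hle⟩ := exists_atoms_le_comp (x := (a.1 : A)) (y := (b.1 : A)) hz
    (hzd.trans h)
  obtain ⟨x, rfl, hxa'⟩ := exists_coverAtom_eq a hx hxa
  obtain ⟨y, rfl, hyb'⟩ := exists_coverAtom_eq b hy hyb
  obtain ⟨z, rfl, hzd'⟩ := exists_coverAtom_eq d hz hzd
  exact ⟨x, y, z, hxa', hyb', hzd', hle⟩

theorem isThinningCover_coverAtom (hsymm : IsSymmetric A) (hspec : IsSpecialExtension E) :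
    IsThinningCover E (coverAtom E) where
  surjective a := by
    obtain ⟨y, hy, h⟩ := (IsAtomic.eq_bot_or_exists_atom_le (a.1 : A)).resolve_left
      fun h0 => a.2.1.1 (Subtype.ext h0)
    obtain ⟨x, -, hx⟩ := exists_coverAtom_eq a hy h
    exact ⟨x, hx⟩
  swap_left := fun h => h.trans (hsymm.comp_comm _ _).le
  swap_right := by
    intro x y z h
    exact le_comp_rotate hsymm y.2.1 z.2.1 h
  uniform := by
    intro x y z x' y' z' h hne hx hy hz
    have h1 := (hspec _ _ _ (coverAtom E x).2 (coverAtom E y).2 (coverAtom E z).2).1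
      (fun h => hne ⟨Subtype.ext h.1, Subtype.ext h.2⟩) (coverAtom_le_comp h) x'.1 y'.1 x'.2.1
      y'.2.1 (coverAtom_eq_iff.1 hx) (coverAtom_eq_iff.1 hy)
    exact (coverAtom_eq_iff.1 hz).trans h1
  extend := by
    intro x y z y' z' h h1 h2 hy hz
    have h3 := coverAtom_le_comp (E := E) h
    rw [← h2, ← h1] at h3
    have h4 := (hspec _ _ _ (coverAtom E x).2 (coverAtom E x).2 (coverAtom E x).2).2 h3 z'.1 y'.1
      z'.2.1 y'.2.1 (coverAtom_eq_iff.1 hz) (coverAtom_eq_iff.1 hy)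
    obtain ⟨w, hw, hle⟩ := (IsAtomic.eq_bot_or_exists_atom_le _).resolve_left h4
    obtain ⟨w, rfl, hwx⟩ := exists_coverAtom_eq (coverAtom E x) hw (hle.trans inf_le_right)
    refine ⟨w, hwx, ?_⟩
    have h5 : w.1 ≤ y'.1 ⨾ z'.1 := (hle.trans inf_le_left).trans (hsymm.comp_comm _ _).le
    exact (le_comp_rotate hsymm z'.2.1 w.2.1 h5).trans (hsymm.comp_comm _ _).le
  sameCover_iff := by
    intro x y z _
    constructor
    · rintro ⟨a, ha, hx, hy, hz⟩
      have key : ∀ w : DivAt A, w.1 ≤ (a : A) → (coverAtom E w).1 = a := fun w hw =>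
        eq_of_isAtom_of_le w.2.1 (coverAtom E w).2.1 ha (le_coverAtom E w) hw
      exact ⟨Subtype.ext ((key x hx).trans (key y hy).symm),
        Subtype.ext ((key y hy).trans (key z hz).symm)⟩
    · rintro ⟨h1, h2⟩
      exact ⟨(coverAtom E x).1, (coverAtom E x).2.1, le_coverAtom E x, h1 ▸ le_coverAtom E y,
        (h1.trans h2) ▸ le_coverAtom E z⟩

theorem exists_isTrio_coverAtom (hsymm : IsSymmetric A) (hint : IsIntegralAlgebra A)
    (htrio : ∃ a b c : E, IsFlexibleTrio a b c) :
    ∃ t, IsTrio (DivCycle (A := A)) (coverAtom E) t := by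
  obtain ⟨a, b, c, ⟨ha, hb, hc⟩, ⟨haa, hbb, hcc⟩, ⟨hab, hac, hbc⟩, hx⟩ := htrio
  have hE : IsSymmetric E := fun x => Subtype.ext (hsymm x)
  have hba := (hE.comp_comm b a).trans hab
  have hca := (hE.comp_comm c a).trans hac
  have hcb := (hE.comp_comm c b).trans hbc
  have hide : (ideᶜ : E) ≠ ⊤ := by
    intro h
    exact hint.1 (congrArg Subtype.val (compl_eq_top.1 h))
  have hpair : ∀ (i j : Fin 3) (e : {a : E // IsDivAtom a}),
      e.1 ≤ (![⟨a, ha⟩, ⟨b, hb⟩, ⟨c, hc⟩] i : {a : E // IsDivAtom a}).1 ⨾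
        (![⟨a, ha⟩, ⟨b, hb⟩, ⟨c, hc⟩] j : {a : E // IsDivAtom a}).1 := by
    intro i j e
    have he := e.2.2
    fin_cases i <;> fin_cases j <;> simp_all
  refine ⟨![⟨a, ha⟩, ⟨b, hb⟩, ⟨c, hc⟩], ?_, fun i j e => exists_divCycle (hpair i j e), ?_⟩
  · have hab' : a ≠ b := by rintro rfl; exact hide (hab.symm.trans haa)
    have hac' : a ≠ c := by rintro rfl; exact hide (hac.symm.trans haa)
    have hbc' : b ≠ c := by rintro rfl; exact hide (hbc.symm.trans hbb)
    intro i j h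
    fin_cases i <;> fin_cases j <;> simp_all
  · intro d
    suffices h : ∃ i : Fin 3, ∀ j, j ≠ i → ∀ e : {a : E // IsDivAtom a},
        e.1 ≤ d.1 ⨾ (![⟨a, ha⟩, ⟨b, hb⟩, ⟨c, hc⟩] j : {a : E // IsDivAtom a}).1 by
      obtain ⟨i, hi⟩ := h
      exact ⟨i, fun j hj e => exists_divCycle (hi j hj e)⟩
    by_cases hd : ∃ i, ![⟨a, ha⟩, ⟨b, hb⟩, ⟨c, hc⟩] i = d
    · obtain ⟨i, rfl⟩ := hd
      exact ⟨0, fun j _ e => hpair i j e⟩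
    · have hdi : d.1 ≠ ide := by
        intro h
        have h1 := d.2.2
        rw [h] at h1
        exact d.2.1.1 (h.trans (le_compl_self.1 h1))
      rcases hx d.1 d.2.1 hdi (fun h => hd ⟨0, Subtype.ext h.symm⟩)
        (fun h => hd ⟨1, Subtype.ext h.symm⟩) (fun h => hd ⟨2, Subtype.ext h.symm⟩) with
        h | h | h
      · refine ⟨2, fun j hj e => ?_⟩
        have he := e.2.2
        fin_cases j <;> simp_all
      · refine ⟨1, fun j hj e => ?_⟩
        have he := e.2.2
        fin_cases j <;> simp_all
      · refine ⟨0, fun j hj e => ?_⟩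
        have he := e.2.2
        fin_cases j <;> simp_all

end SubalgebraCover

/-! ### The cover induced by the atom-generated subalgebra -/

namespace SplitAlgebra

variable {A : Type u} [NonassocRelAlgebra A] {κ : Type v} {E : Subalg A} {c : DivAt A → κ}

/-- The atom, as an element of the algebra. -/
def single (E : Subalg A) (p : SplitAtom A) : SplitAlgebra E := ofPred E (· = p)

theorem mem_single {p q : SplitAtom A} : p ∈ single E q ↔ p = q := Iff.rfl

theorem mem_single_comp {p q r : SplitAtom A} :
    r ∈ single E p ⨾ single E q ↔ (p, q, r) ∈ cycles E := by
  constructor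
  · rintro ⟨_, rfl, _, rfl, h⟩
    exact h
  · exact fun h => ⟨p, rfl, q, rfl, h⟩

/-- The `i`-th copy of a diversity atom. -/
abbrev copyAt (x : DivAt A) (i : ℕ) : SplitAtom A := .copy x.1 x.2 i

theorem mem_level_copy (hc : IsThinningCover E c) {n : ℕ} {X : SplitAlgebra E}
    (hX : X ∈ level hc n) {x y : DivAt A} (h : c x = c y) {i j : ℕ} (hi : n ≤ i) (hj : n ≤ j)
    (hx : copyAt x i ∈ X) : copyAt y j ∈ X := by
  refine hX _ _ ?_ hx
  simp only [SplitAtom.label, Label.collapse, hi.not_gt, hj.not_gt, if_false]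
  exact congrArg _ h

/-- The elements of `B` that contain almost all copies of `x`. -/
def limitSet (B : Subalg (SplitAlgebra E)) (x : DivAt A) : Set (SplitAlgebra E) :=
  {X | X ∈ B ∧ ∀ᶠ i in Filter.atTop, copyAt x i ∈ X}

/-- The cover by the relation that holds if `B` does not separate the copies of large index. -/
def limitCover (B : Subalg (SplitAlgebra E)) (x : DivAt A) : Set.range (limitSet B) :=
  ⟨limitSet B x, x, rfl⟩

theorem eventually_of_limitCover_eq {B : Subalg (SplitAlgebra E)} {x y : DivAt A}
    (h : limitCover B x = limitCover B y) {X : SplitAlgebra E} (hX : X ∈ B)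
    (hx : ∀ᶠ i in Filter.atTop, copyAt x i ∈ X) : ∀ᶠ i in Filter.atTop, copyAt y i ∈ X := by
  have h1 : X ∈ limitSet B x := ⟨hX, hx⟩
  rw [show limitSet B x = limitSet B y from congrArg Subtype.val h] at h1
  exact h1.2

/-- `B` contains all atoms, and each of its elements belongs to a level with respect to `c`. -/
structure IsAtomDense (hc : IsThinningCover E c) (B : Subalg (SplitAlgebra E)) : Prop where
  single_mem : ∀ p, single E p ∈ B
  exists_level : ∀ X ∈ B, ∃ n, X ∈ level hc n

theorem biUnion_mem (B : Subalg (SplitAlgebra E)) {ι : Type w} {s : Set ι} (hs : s.Finite)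
    (f : ι → SplitAlgebra E) (hf : ∀ i ∈ s, f i ∈ B) :
    (ofPred E fun p => ∃ i ∈ s, p ∈ f i) ∈ B := by
  induction s, hs using Set.Finite.induction_on with
  | empty =>
    have h : (ofPred E fun p => ∃ i ∈ (∅ : Set ι), p ∈ f i) = ⊥ :=
      ext fun p => ⟨fun ⟨_, h, _⟩ => h.elim, fun h => h.elim⟩
    rw [h]
    exact B.bot_mem'
  | @insert a s _ _ ih =>
    have h : (ofPred E fun p => ∃ i ∈ insert a s, p ∈ f i) =
        f a ⊔ ofPred E fun p => ∃ i ∈ s, p ∈ f i :=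
      ext fun p => by simp [mem_ofPred, mem_sup]
    rw [h]
    exact B.supClosed' (hf a (Set.mem_insert a s))
      (ih fun i hi => hf i (Set.mem_insert_of_mem a hi))

theorem biInter_mem (B : Subalg (SplitAlgebra E)) {ι : Type w} {s : Set ι} (hs : s.Finite)
    (f : ι → SplitAlgebra E) (hf : ∀ i ∈ s, f i ∈ B) :
    (ofPred E fun p => ∀ i ∈ s, p ∈ f i) ∈ B := by
  have h : (ofPred E fun p => ∀ i ∈ s, p ∈ f i) = (ofPred E fun p => ∃ i ∈ s, p ∈ (f i)ᶜ)ᶜ :=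
    ext fun p => by simp [mem_ofPred, mem_compl]
  rw [h]
  exact B.compl_mem' (biUnion_mem B hs (fun i => (f i)ᶜ) fun i hi => B.compl_mem' (hf i hi))

namespace IsAtomDense

variable {hc : IsThinningCover E c} {B : Subalg (SplitAlgebra E)}

theorem limitCover_eq (hB : IsAtomDense hc B) {x y : DivAt A} (h : c x = c y) :
    limitCover B x = limitCover B y := by
  have key : ∀ {x y : DivAt A}, c x = c y → limitSet B x ⊆ limitSet B y := by
    rintro x y h X ⟨hX, hx⟩
    obtain ⟨n, hn⟩ := hB.exists_level X hX
    refine ⟨hX, ?_⟩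
    filter_upwards [hx, Filter.eventually_ge_atTop n] with i hi hni
    exact mem_level_copy hc hn h hni hni hi
  exact Subtype.ext ((key h).antisymm (key h.symm))

theorem eventually_or (hB : IsAtomDense hc B) {X : SplitAlgebra E} (hX : X ∈ B) (x : DivAt A) :
    (∀ᶠ i in Filter.atTop, copyAt x i ∈ X) ∨ (∀ᶠ i in Filter.atTop, copyAt x i ∉ X) := by
  obtain ⟨n, hn⟩ := hB.exists_level X hX
  by_cases h : copyAt x n ∈ X
  · exact Or.inl ((Filter.eventually_ge_atTop n).mono fun i hi =>
      mem_level_copy hc hn rfl le_rfl hi h)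
  · exact Or.inr ((Filter.eventually_ge_atTop n).mono fun i hi h' =>
      h (mem_level_copy hc hn rfl hi le_rfl h'))

theorem finite_mem (hB : IsAtomDense hc B) {s : Set (SplitAtom A)} (hs : s.Finite) :
    ofPred E (· ∈ s) ∈ B := by
  have h : ofPred E (· ∈ s) = ofPred E fun p => ∃ q ∈ s, p ∈ single E q :=
    ext fun p => by simp [mem_ofPred, mem_single]
  rw [h]
  exact biUnion_mem B hs (single E) fun p _ => hB.single_mem p

/-- `B` consists of all sets that are almost constant on the blocks of its limit cover. -/
theorem mem_of_eventually [Finite A] (hB : IsAtomDense hc B) {Z : SplitAlgebra E}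
    (h1 : ∀ x, (∀ᶠ i in Filter.atTop, copyAt x i ∈ Z) ∨ (∀ᶠ i in Filter.atTop, copyAt x i ∉ Z))
    (h2 : ∀ x y, limitCover B x = limitCover B y → (∀ᶠ i in Filter.atTop, copyAt x i ∈ Z) →
      ∀ᶠ i in Filter.atTop, copyAt y i ∈ Z) : Z ∈ B := by
  have hsep : ∀ x y, limitCover B x ≠ limitCover B y → ∃ X ∈ B,
      (∀ᶠ i in Filter.atTop, copyAt x i ∈ X) ∧ ∀ᶠ i in Filter.atTop, copyAt y i ∉ X := by
    intro x y hxy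
    have hne : limitSet B x ≠ limitSet B y := fun h => hxy (Subtype.ext h)
    by_contra hcon
    push Not at hcon
    apply hne
    refine Set.Subset.antisymm ?_ ?_
    · rintro X ⟨hX, hx⟩
      exact ⟨hX, (hB.eventually_or hX y).resolve_right (hcon X hX hx)⟩
    · rintro X ⟨hX, hy⟩
      refine ⟨hX, (hB.eventually_or hX x).resolve_right fun hx => ?_⟩
      exact hcon Xᶜ (B.compl_mem' hX) hx (hy.mono fun i hi h => h hi)
  choose! sep hsepB hsepx hsepy using hsep
  -- `W x` contains almost all copies of the members of the block of `x`, and few others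
  let W : DivAt A → SplitAlgebra E := fun x =>
    ofPred E fun p => ∀ y ∈ {y | limitCover B x ≠ limitCover B y}, p ∈ sep x y
  have hWB : ∀ x, W x ∈ B := fun x =>
    biInter_mem B (Set.toFinite _) (sep x) fun y hy => hsepB x y hy
  have hWx : ∀ x, ∀ᶠ i in Filter.atTop, copyAt x i ∈ W x := by
    intro x
    have : ∀ᶠ i in Filter.atTop, ∀ y, limitCover B x ≠ limitCover B y →
        copyAt x i ∈ sep x y :=
      Filter.eventually_all.2 fun y => by
        by_cases h : limitCover B x = limitCover B y
        · exact Filter.Eventually.of_forall fun i h' => absurd h h'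
        · exact (hsepx x y h).mono fun i hi _ => hi
    exact this
  have hWy : ∀ x y, limitCover B x ≠ limitCover B y →
      ∀ᶠ i in Filter.atTop, copyAt y i ∉ W x := by
    intro x y h
    exact (hsepy x y h).mono fun i hi h' => hi (h' y h)
  let Y : SplitAlgebra E := ofPred E fun p =>
    ∃ x ∈ {x | ∀ᶠ i in Filter.atTop, copyAt x i ∈ Z}, p ∈ W x
  have hYB : Y ∈ B := biUnion_mem B (Set.toFinite _) W fun x _ => hWB x
  have hagree : ∀ᶠ i in Filter.atTop, ∀ y, (copyAt y i ∈ Y ↔ copyAt y i ∈ Z) := by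
    refine Filter.eventually_all.2 fun y => ?_
    rcases h1 y with h | h
    · filter_upwards [h, hWx y] with i hi hi'
      exact ⟨fun _ => hi, fun _ => ⟨y, h, hi'⟩⟩
    · have h3 : ∀ᶠ i in Filter.atTop, ∀ x, (∀ᶠ i in Filter.atTop, copyAt x i ∈ Z) →
          copyAt y i ∉ W x := by
        refine Filter.eventually_all.2 fun x => ?_
        by_cases hx : ∀ᶠ i in Filter.atTop, copyAt x i ∈ Z
        · refine (hWy x y fun hxy => ?_).mono fun i hi _ => hi
          obtain ⟨i, h4, h5⟩ := ((h2 x y hxy hx).and h).exists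
          exact h5 h4
        · exact Filter.Eventually.of_forall fun i h' => absurd h' hx
      filter_upwards [h, h3] with i hi hi'
      exact ⟨fun ⟨x, hx, h'⟩ => absurd h' (hi' x hx), fun h' => absurd h' hi⟩
  obtain ⟨n, hn⟩ := Filter.eventually_atTop.1 hagree
  have hfin : {p : SplitAtom A | ¬ (p ∈ Y ↔ p ∈ Z)}.Finite := by
    refine ((Set.finite_singleton SplitAtom.one).union (Set.finite_range
      fun a : DivAt A × Fin n => copyAt a.1 a.2)).subset ?_
    intro p hp
    cases p with
    | one => exact Or.inl rfl
    | copy x hx i =>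
      refine Or.inr ⟨(⟨x, hx⟩, ⟨i, ?_⟩), rfl⟩
      by_contra h
      exact hp (hn i (not_lt.1 h) ⟨x, hx⟩)
  have hF1 : ofPred E (· ∈ {p | p ∈ Y ∧ p ∉ Z}) ∈ B :=
    hB.finite_mem (hfin.subset fun p hp h => hp.2 (h.1 hp.1))
  have hF2 : ofPred E (· ∈ {p | p ∈ Z ∧ p ∉ Y}) ∈ B :=
    hB.finite_mem (hfin.subset fun p hp h => hp.2 (h.2 hp.1))
  have hZ : Z = (Y ⊓ (ofPred E (· ∈ {p | p ∈ Y ∧ p ∉ Z}))ᶜ) ⊔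
      ofPred E (· ∈ {p | p ∈ Z ∧ p ∉ Y}) := by
    refine ext fun p => ?_
    change p ∈ Z ↔ (p ∈ Y ∧ ¬ (p ∈ Y ∧ p ∉ Z)) ∨ (p ∈ Z ∧ p ∉ Y)
    tauto
  rw [hZ]
  exact B.supClosed' (B.infClosed' hYB (B.compl_mem' hF1)) hF2

theorem single_comp_mem (hB : IsAtomDense hc B) (p q : SplitAtom A) :
    single E p ⨾ single E q ∈ B :=
  B.comp_mem' (hB.single_mem p) (hB.single_mem q)

/-- A cycle inside a block of the limit cover lies inside a block of the original cover. If `x` and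
`y` had different original blocks, then `x⁽⁰⁾ ⨾ y⁽⁰⁾` would contain all copies of `z`, hence almost
all of `x`, so that `x, x, y` would form a cycle; but `x⁽⁰⁾ ⨾ x⁽⁰⁾` would then contain all copies of
`y` and, by thinning, only finitely many of `x`. -/
theorem eq_of_divCycle (hB : IsAtomDense hc B) {x y z : DivAt A} (h : DivCycle x y z)
    (h1 : limitCover B x = limitCover B y) (h2 : limitCover B y = limitCover B z) :
    c x = c y ∧ c y = c z := by
  have key : ∀ {x y z : DivAt A}, DivCycle x y z → limitCover B x = limitCover B y →
      limitCover B y = limitCover B z → c x = c y := by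
    intro x y z h h1 h2
    by_contra hne
    have hz : ∀ᶠ k in Filter.atTop, copyAt z k ∈ single E (copyAt x 0) ⨾ single E (copyAt y 0) :=
      Filter.Eventually.of_forall fun k => mem_single_comp.2
        ((SplitAtom.copy_mem_cycles_iff hc).2 ⟨h, fun h' => absurd h' hne⟩)
    obtain ⟨k, hk⟩ := (eventually_of_limitCover_eq (h1.trans h2).symm (hB.single_comp_mem _ _)
      hz).exists
    have hxyx := ((SplitAtom.copy_mem_cycles_iff hc).1 (mem_single_comp.1 hk)).1
    have hxxy := hc.swap_right hxyx
    have hy : ∀ᶠ k in Filter.atTop, copyAt y k ∈ single E (copyAt x 0) ⨾ single E (copyAt x 0) :=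
      Filter.Eventually.of_forall fun k => mem_single_comp.2
        ((SplitAtom.copy_mem_cycles_iff hc).2 ⟨hxxy, fun _ h' => absurd h' hne⟩)
    obtain ⟨k, hk, hk1⟩ := ((eventually_of_limitCover_eq h1.symm (hB.single_comp_mem _ _) hy).and
      (Filter.eventually_ge_atTop 1)).exists
    have := ((SplitAtom.copy_mem_cycles_iff hc).1 (mem_single_comp.1 hk)).2 rfl rfl
    simp only [Thin] at this
    omega
  have hxy := key h h1 h2
  exact ⟨hxy, hxy.symm.trans (key (hc.swap_right h) (h1.trans h2) h2.symm)⟩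

variable [Finite A]

/-- A block of the limit cover that contains a cycle is a block of the original cover: the product
of `x⁽⁰⁾` with almost all of the block contains almost all copies of `z`, hence of `x'`, so that `x`
and `x'` belong to a cycle inside the block. -/
theorem eq_of_limitCover_eq (hB : IsAtomDense hc B) {x y z x' : DivAt A} (h : DivCycle x y z)
    (h1 : c x = c y) (h2 : c y = c z) (hx' : limitCover B x' = limitCover B x) : c x' = c x := by
  let X : SplitAlgebra E := ofPred E fun p =>
    ∃ w j, 1 ≤ j ∧ limitCover B w = limitCover B x ∧ p = copyAt w j
  have hmem : ∀ w j, copyAt w j ∈ X ↔ 1 ≤ j ∧ limitCover B w = limitCover B x := by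
    intro w j
    constructor
    · rintro ⟨w', j', hj, hw, h⟩
      simp only [SplitAtom.copy.injEq, Subtype.val_inj] at h
      obtain ⟨rfl, rfl⟩ := h
      exact ⟨hj, hw⟩
    · rintro ⟨hj, hw⟩
      exact ⟨w, j, hj, hw, rfl⟩
  have hX : X ∈ B := by
    refine hB.mem_of_eventually (fun w => ?_) fun w w' hw h => ?_
    · by_cases hw : limitCover B w = limitCover B x
      · exact Or.inl ((Filter.eventually_ge_atTop 1).mono fun i hi => (hmem w i).2 ⟨hi, hw⟩)
      · exact Or.inr (Filter.Eventually.of_forall fun i h => hw ((hmem w i).1 h).2)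
    · filter_upwards [h] with i hi
      rw [hmem] at hi ⊢
      exact ⟨hi.1, hw.symm.trans hi.2⟩
  have hP := B.comp_mem' (hB.single_mem (copyAt x 0)) hX
  have hz : ∀ᶠ j in Filter.atTop, copyAt z j ∈ single E (copyAt x 0) ⨾ X := by
    filter_upwards [Filter.eventually_ge_atTop 1] with j hj
    exact ⟨_, rfl, copyAt y j, (hmem y j).2 ⟨hj, (hB.limitCover_eq h1).symm⟩,
      (SplitAtom.copy_mem_cycles_iff hc).2 ⟨h, fun _ _ => Or.inl ⟨Nat.zero_le j, rfl⟩⟩⟩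
  obtain ⟨k, _, rfl, _, ⟨w, l, -, hw, rfl⟩, hcyc⟩ := (eventually_of_limitCover_eq
    ((hB.limitCover_eq (h1.trans h2)).symm.trans hx'.symm) hP hz).exists
  have hxw := ((SplitAtom.copy_mem_cycles_iff hc).1 hcyc).1
  obtain ⟨h3, h4⟩ := hB.eq_of_divCycle hxw hw.symm (hw.trans hx'.symm)
  exact (h3.trans h4).symm

/-- The limit cover yields the same algebra as the original cover. -/
theorem isThinningCover (hB : IsAtomDense hc B) : IsThinningCover E (limitCover B) where
  surjective := by
    rintro ⟨_, x, rfl⟩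
    exact ⟨x, rfl⟩
  swap_left := hc.swap_left
  swap_right := hc.swap_right
  uniform := by
    have key : ∀ {x y z z' : DivAt A}, DivCycle x y z →
        ¬ (limitCover B x = limitCover B y ∧ limitCover B y = limitCover B z) →
        limitCover B z' = limitCover B z → DivCycle x y z' := by
      intro x y z z' h hne hz
      have hz1 : ∀ᶠ k in Filter.atTop,
          copyAt z k ∈ single E (copyAt x 0) ⨾ single E (copyAt y 0) :=
        Filter.Eventually.of_forall fun k => mem_single_comp.2
          ((SplitAtom.copy_mem_cycles_iff hc).2 ⟨h, fun h1 h2 =>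
            absurd ⟨hB.limitCover_eq h1, hB.limitCover_eq h2⟩ hne⟩)
      obtain ⟨k, hk⟩ := (eventually_of_limitCover_eq hz.symm (hB.single_comp_mem _ _) hz1).exists
      exact ((SplitAtom.copy_mem_cycles_iff hc).1 (mem_single_comp.1 hk)).1
    intro x y z x' y' z' h hne hx hy hz
    have h1 : DivCycle x y z' := key h hne hz
    have h2 : DivCycle x z' y' := key (hc.swap_right h1) (by rw [hz]; grind) hy
    have h3 : DivCycle y' z' x' := key (hc.swap_right (hc.swap_left (hc.swap_right h2)))
      (by rw [hz, hy]; grind) hx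
    exact hc.swap_left (hc.swap_right h3)
  extend := by
    intro x y z y' z' h h1 h2 hy hz
    obtain ⟨h3, h4⟩ := hB.eq_of_divCycle h h1 h2
    obtain ⟨x', hx', h'⟩ := hc.extend h h3 h4 (hB.eq_of_limitCover_eq h h3 h4 hy)
      (hB.eq_of_limitCover_eq h h3 h4 hz)
    exact ⟨x', hB.limitCover_eq hx', h'⟩
  sameCover_iff := by
    intro x y z h
    rw [hc.sameCover_iff h]
    exact ⟨fun h' => ⟨hB.limitCover_eq h'.1, hB.limitCover_eq h'.2⟩,
      fun h' => hB.eq_of_divCycle h h'.1 h'.2⟩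

theorem exists_isTrio (hB : IsAtomDense hc B) {t : Fin 3 → κ}
    (ht : IsTrio (DivCycle (A := A)) c t) :
    ∃ t', IsTrio (DivCycle (A := A)) (limitCover B) t' := by
  choose s hs using fun i => hc.surjective (t i)
  refine ⟨fun i => limitCover B (s i), ?_, ?_, ?_⟩
  · intro i j h
    obtain ⟨x, y, z, hx, hy, hz, hR⟩ := ht.pair i i (t i)
    have h1 := hB.eq_of_limitCover_eq (x' := s j) hR (hx.trans hy.symm) (hy.trans hz.symm)
      (Eq.trans (Eq.symm h) (hB.limitCover_eq ((hs i).trans hx.symm)))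
    exact ht.injective (hx.symm.trans (h1.symm.trans (hs j)))
  · rintro i j ⟨_, w, rfl⟩
    obtain ⟨x, y, z, hx, hy, hz, hR⟩ := ht.pair i j (c w)
    exact ⟨x, y, z, hB.limitCover_eq (hx.trans (hs i).symm),
      hB.limitCover_eq (hy.trans (hs j).symm), hB.limitCover_eq hz, hR⟩
  · rintro ⟨_, v, rfl⟩
    obtain ⟨i, hi⟩ := ht.other (c v)
    refine ⟨i, ?_⟩
    rintro j hj ⟨_, w, rfl⟩
    obtain ⟨x, y, z, hx, hy, hz, hR⟩ := hi j hj (c w)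
    exact ⟨x, y, z, hB.limitCover_eq hx, hB.limitCover_eq (hy.trans (hs j).symm),
      hB.limitCover_eq hz, hR⟩

/-- Unlike those of the original cover, the levels of the limit cover lie inside `B`. -/
theorem level_le (hB : IsAtomDense hc B) (n : ℕ) {X : SplitAlgebra E}
    (hX : X ∈ level hB.isThinningCover n) : X ∈ B := by
  refine hB.mem_of_eventually (fun x => ?_) fun x y hxy h => ?_
  · by_cases h : copyAt x n ∈ X
    · exact Or.inl ((Filter.eventually_ge_atTop n).mono fun i hi =>
        mem_level_copy _ hX rfl le_rfl hi h)
    · exact Or.inr ((Filter.eventually_ge_atTop n).mono fun i hi h' =>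
        h (mem_level_copy _ hX rfl hi le_rfl h'))
  · filter_upwards [h, Filter.eventually_ge_atTop n] with i hi hni
    exact mem_level_copy _ hX hxy hni hni hi

theorem exists_mem_level (hB : IsAtomDense hc B) {X : SplitAlgebra E} (hX : X ∈ B) :
    ∃ n, X ∈ level hB.isThinningCover n := by
  obtain ⟨n, hn⟩ := hB.exists_level X hX
  refine ⟨n, fun p q hpq hp => ?_⟩
  cases p with
  | one =>
    have h1 : (q.label _).collapse (limitCover B) n = .one := hpq.symm
    rw [Label.collapse_eq_one] at h1
    rwa [SplitAtom.label_injective (κ := Set.range (limitSet B)) (a₁ := q) (a₂ := .one) h1]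
  | copy x hx i =>
    cases q with
    | one =>
      have h1 : ((SplitAtom.copy x hx i).label _).collapse (limitCover B) n = .one := hpq
      rw [Label.collapse_eq_one] at h1
      cases h1
    | copy y hy j =>
      simp only [SplitAtom.label, Label.collapse] at hpq
      split_ifs at hpq with hi hj hj
      · simp only [Label.fin.injEq, Subtype.mk.injEq] at hpq
        obtain ⟨rfl, rfl⟩ := hpq
        exact hp
      · have h1 : limitCover B ⟨x, hx⟩ = limitCover B ⟨y, hy⟩ := Label.inf.inj hpq
        obtain ⟨k, hk, hnk⟩ := ((eventually_of_limitCover_eq h1 hX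
          ((Filter.eventually_ge_atTop n).mono fun k hk =>
            mem_level_copy hc hn (x := ⟨x, hx⟩) rfl (not_lt.1 hi) hk hp)).and
          (Filter.eventually_ge_atTop n)).exists
        exact mem_level_copy hc hn (x := ⟨y, hy⟩) (y := ⟨y, hy⟩) rfl hnk (not_lt.1 hj) hk

end IsAtomDense
end SplitAlgebra

/-! ### Representations and monochromatic triangles -/

/-- Infinitely many points whose pairs are covered by finitely many relations contain a
monochromatic triangle. -/
theorem exists_monochromatic_triangle {U : Type v} {ι : Type u} [Finite ι] (w : ℕ → U)
    (hw : Function.Injective w) (P : ι → U → U → Prop)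
    (h : ∀ i j, w i ≠ w j → ∃ k, P k (w i) (w j)) :
    ∃ k x y z, P k x y ∧ P k y z ∧ P k x z := by
  let 𝒰 : Ultrafilter ℕ := Filter.hyperfilter ℕ
  have hne : ∀ i : ℕ, ∀ᶠ j in (𝒰 : Filter ℕ), w i ≠ w j := by
    intro i
    have h1 : ∀ᶠ j in Filter.cofinite, w i ≠ w j := by
      refine (Set.finite_singleton i).subset fun j hj => ?_
      by_contra hji
      exact hj fun h' => hji (hw h').symm
    exact Filter.hyperfilter_le_cofinite h1
  have huniv : ∀ p : ι → ℕ → Prop, (∀ᶠ j in (𝒰 : Filter ℕ), ∃ k, p k j) →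
      ∃ k, ∀ᶠ j in (𝒰 : Filter ℕ), p k j := by
    intro p hp
    by_contra hcon
    push Not at hcon
    have h2 : ∀ᶠ j in (𝒰 : Filter ℕ), ∀ k, ¬ p k j :=
      Filter.eventually_all.2 hcon
    obtain ⟨j, ⟨k, h3⟩, h4⟩ := (hp.and h2).exists
    exact h4 k h3
  -- the colour that most points prefer
  obtain ⟨k, hk⟩ := huniv (fun k i => ∀ᶠ j in (𝒰 : Filter ℕ), P k (w i) (w j))
    (Filter.Eventually.of_forall fun i => huniv _ ((hne i).mono fun j => h i j))
  obtain ⟨i, hi⟩ := hk.exists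
  obtain ⟨j, hij, hj⟩ := (hi.and hk).exists
  obtain ⟨l, hil, hjl⟩ := (hi.and hj).exists
  exact ⟨k, w i, w j, w l, hij, hjl, hil⟩

namespace IsRepresentation

variable {D : Type u} [NonassocRelAlgebra D] {U : Type v} {ρ : D → SetRel U U}

theorem mono (hρ : IsRepresentation ρ) {a b : D} (h : a ≤ b) : ρ a ⊆ ρ b := by
  rw [← sup_eq_right.2 h, hρ.map_sup]
  exact Set.subset_union_left

theorem map_bot (hρ : IsRepresentation ρ) : ρ ⊥ = ∅ := by
  rw [← compl_top, hρ.map_compl]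
  exact Set.sdiff_self

theorem not_mem_of_disjoint (hρ : IsRepresentation ρ) {a b : D} (h : Disjoint a b) {e : U × U}
    (ha : e ∈ ρ a) : e ∉ ρ b := by
  have h1 := hρ.mono h.le_compl_right ha
  rw [hρ.map_compl] at h1
  exact h1.2

theorem exists_mem_of_mem_sup (hρ : IsRepresentation ρ) {ι : Type w} (s : Finset ι) (X : ι → D)
    {e : U × U} (h : e ∈ ρ (s.sup X)) : ∃ i, e ∈ ρ (X i) := by
  classical
  induction s using Finset.induction_on with
  | empty =>
    rw [Finset.sup_empty, hρ.map_bot] at h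
    exact h.elim
  | insert a s _ ih =>
    rw [Finset.sup_insert, hρ.map_sup] at h
    exact h.elim (fun h => ⟨a, h⟩) ih

/-- A nonzero element below the products of infinitely many disjoint elements with a fixed element
gives infinitely many points in one class of the unit. -/
theorem exists_injective (hρ : IsRepresentation ρ) {p : ℕ → D} {r s : D}
    (hp : ∀ i j, i ≠ j → Disjoint (p i) (p j)) (hr : r ≠ ⊥) (h : ∀ i, r ≤ p i ⨾ s) :
    ∃ w : ℕ → U, Function.Injective w ∧ ∀ i j, (w i, w j) ∈ ρ ⊤ := by
  obtain ⟨⟨a, b⟩, hab⟩ : (ρ r).Nonempty := by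
    rw [Set.nonempty_iff_ne_empty, ← hρ.map_bot]
    exact fun h => hr (hρ.injective h)
  have h1 : ∀ i, ∃ x, (a, x) ∈ ρ (p i) := by
    intro i
    have h2 := hρ.mono (h i) hab
    rw [hρ.map_comp] at h2
    obtain ⟨x, hx, -⟩ := h2
    exact ⟨x, hx⟩
  choose w hw using h1
  refine ⟨w, fun i j hij => ?_, fun i j => ?_⟩
  · by_contra hne
    have h2 := hw i
    rw [hij] at h2
    exact hρ.not_mem_of_disjoint (hp i j hne) h2 (hw j)
  · have h2 : (w i, a) ∈ ρ (conv (p i)) := by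
      rw [hρ.map_conv]
      exact hw i
    have h3 : (w i, w j) ∈ ρ (conv (p i) ⨾ p j) := by
      rw [hρ.map_comp]
      exact ⟨a, h2, hw j⟩
    exact hρ.mono le_top h3

end IsRepresentation

/-- By the Peircean law relative multiplication distributes over existing joins; so the join of a
set without cycles has no 1-cycle. -/
theorem disjoint_comp_of_isLUB {D : Type u} [NonassocRelAlgebra D] {S : Set D} {s : D}
    (hs : IsLUB S s) (h : ∀ a ∈ S, ∀ b ∈ S, ∀ d ∈ S, Disjoint (a ⨾ b) d) :
    Disjoint (s ⨾ s) s := by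
  have key : ∀ {t : D}, (∀ a ∈ S, Disjoint t a) → Disjoint t s := by
    intro t ht
    exact (le_compl_iff_disjoint_right.1 (hs.2 fun a ha => (ht a ha).symm.le_compl_right)).symm
  refine key fun d hd => disjoint_comp_left.2 (key fun a ha => ?_)
  rw [← disjoint_comp_left, disjoint_comp_right]
  refine key fun b hb => ?_
  rw [← disjoint_comp_right]
  exact h a ha b hb d hd

namespace IsAlgEmbedding

variable {α : Type u} {β : Type w} [NonassocRelAlgebra α] [NonassocRelAlgebra β] {e : α → β}

theorem mono (he : IsAlgEmbedding e) {a b : α} (h : a ≤ b) : e a ≤ e b := by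
  rw [← sup_eq_right.2 h, he.map_sup]
  exact le_sup_left

theorem disjoint (he : IsAlgEmbedding e) {a b : α} (h : Disjoint a b) : Disjoint (e a) (e b) :=
  le_compl_iff_disjoint_right.1 ((he.mono h.le_compl_right).trans (he.map_compl b).le)

theorem map_bot (he : IsAlgEmbedding e) : e ⊥ = ⊥ := by
  have h1 := he.mono (bot_le : (⊥ : α) ≤ ⊥ᶜ)
  rw [he.map_compl] at h1
  exact le_compl_self.1 h1

end IsAlgEmbedding

namespace SplitAlgebra

variable {A : Type u} [NonassocRelAlgebra A] {κ : Type v} {E : Subalg A} {c : DivAt A → κ}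
  {hc : IsThinningCover E c} {B : Subalg (SplitAlgebra E)}

theorem isAtom_single (p : SplitAtom A) : IsAtom (single E p) := isAtom_iff.2 ⟨p, rfl⟩

theorem isAtomDense_atomGenerated (hc : IsThinningCover E c) :
    IsAtomDense hc (Subalg.atomGenerated (SplitAlgebra E)) where
  single_mem := fun p _ hS => hS (isAtom_single p)
  exists_level := by
    have h2 : ∀ {X Y : SplitAlgebra E}, (∃ n, X ∈ level hc n) → (∃ n, Y ∈ level hc n) →
        ∃ n, X ∈ level hc n ∧ Y ∈ level hc n := by
      rintro X Y ⟨n, hn⟩ ⟨m, hm⟩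
      exact ⟨max n m, level_mono hc (le_max_left n m) hn, level_mono hc (le_max_right n m) hm⟩
    let S : Subalg (SplitAlgebra E) :=
      { carrier := {X | ∃ n, X ∈ level hc n}
        supClosed' := fun _ hX _ hY =>
          (h2 hX hY).imp fun n h => (level hc n).supClosed' h.1 h.2
        infClosed' := fun _ hX _ hY =>
          (h2 hX hY).imp fun n h => (level hc n).infClosed' h.1 h.2
        compl_mem' := fun h => h.imp fun n h => (level hc n).compl_mem' h
        bot_mem' := ⟨0, (level hc 0).bot_mem'⟩
        comp_mem' := fun hX hY => (h2 hX hY).imp fun n h => (level hc n).comp_mem' h.1 h.2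
        conv_mem' := fun h => h
        ide_mem' := ⟨0, (level hc 0).ide_mem'⟩ }
    intro X hX
    refine hX S ?_
    intro Y hY
    obtain ⟨p, rfl⟩ := isAtom_iff.1 hY
    obtain ⟨n, hn⟩ := (Label.eventually_isBelow (p.label κ)).exists
    refine ⟨n, fun q q' h hq => ?_⟩
    obtain rfl : q = p := hq
    rw [Label.collapse_of_isBelow hn] at h
    refine SplitAtom.label_injective (κ := κ) ?_
    cases q' with
    | one => exact h.symm
    | copy x hx i =>
      simp only [SplitAtom.label, Label.collapse] at h ⊢
      split_ifs at h with hi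
      · exact h.symm
      · have h3 := SplitAtom.isFine_label (κ := κ) q
        rw [show q.label κ = _ from h] at h3
        exact h3.elim

/-- An atom of the split algebra, as an element of `B`. -/
def IsAtomDense.atom (hB : IsAtomDense hc B) (p : SplitAtom A) : B := ⟨single E p, hB.single_mem p⟩

theorem isCompletionVia (hB : IsAtomDense hc B) :
    IsCompletionVia (fun b : B => (b : SplitAlgebra E)) := by
  refine ⟨⟨Subtype.val_injective, fun _ _ => rfl, fun _ => rfl, fun _ _ => rfl, fun _ => rfl, rfl⟩,
    fun X => ⟨ofPred E fun p => ∃ Y ∈ X, p ∈ Y, fun Y hY p hp => ⟨Y, hY, hp⟩, ?_⟩, fun d hd => ?_⟩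
  · rintro Z hZ p ⟨Y, hY, hp⟩
    exact hZ hY hp
  · obtain ⟨p, hp⟩ := exists_mem_of_ne_bot hd
    refine ⟨hB.atom p, fun h => (isAtom_single p).1 (congrArg Subtype.val h), ?_⟩
    rintro q rfl
    exact hp

theorem exists_level_subalg (hB : IsAtomDense hc B) (hBc : ∀ n, ∀ X ∈ level hc n, X ∈ B)
    {t : Fin 3 → κ} (ht : IsTrio (DivCycle (A := A)) c t) (F : Subalg B) (hF : F.FG) :
    ∃ G : Subalg B, (F : Set B) ⊆ G ∧ HasOnePointExtension G := by
  obtain ⟨X, hX, rfl⟩ := hF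
  obtain ⟨n, hn⟩ : ∃ n, ∀ b ∈ X, b.1 ∈ level hc n := by
    have h : ∀ᶠ n in Filter.atTop, ∀ b ∈ X, b.1 ∈ level hc n :=
      (Filter.eventually_all_finite hX).2 fun b _ => by
        obtain ⟨n, hn⟩ := hB.exists_level b.1 b.2
        exact (Filter.eventually_ge_atTop n).mono fun m hm => level_mono hc hm hn
    exact h.exists
  let G : Subalg B :=
    { carrier := {b | b.1 ∈ level hc n}
      supClosed' := fun _ hX _ hY => (level hc n).supClosed' hX hY
      infClosed' := fun _ hX _ hY => (level hc n).infClosed' hX hY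
      compl_mem' := fun h => (level hc n).compl_mem' h
      bot_mem' := (level hc n).bot_mem'
      comp_mem' := fun hX hY => (level hc n).comp_mem' hX hY
      conv_mem' := fun h => h
      ide_mem' := (level hc n).ide_mem' }
  refine ⟨G, fun b hb => hb G hn, ?_⟩
  refine hasOnePointExtension_of_level hc ht n (fun g : G => (g.1.1 : SplitAlgebra E))
    (fun _ _ => Iff.rfl) (fun _ _ => rfl) (fun _ => rfl) rfl fun Y => ⟨fun hY => ?_, ?_⟩
  · exact ⟨⟨⟨Y, hBc n Y hY⟩, hY⟩, rfl⟩
  · rintro ⟨g, rfl⟩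
    exact g.2

theorem not_divCycle_self (h1 : HasNoOneCycles A) (x : DivAt A) : ¬ DivCycle x x x := by
  intro h
  refine x.2.1.1 (le_bot_iff.1 ((le_inf h le_rfl).trans (h1 x.1 x.2.1 ?_).le))
  intro h2
  have h3 := x.2.2
  rw [← h2] at h3
  exact x.2.1.1 (le_compl_self.1 h3)

theorem IsAtomDense.disjoint_atom (hB : IsAtomDense hc B) {p q : SplitAtom A} (h : p ≠ q) :
    Disjoint (hB.atom p) (hB.atom q) := by
  rw [disjoint_iff]
  refine Subtype.ext (ext fun r => ⟨?_, fun h => h.elim⟩)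
  rintro ⟨rfl, rfl⟩
  exact h rfl

/-- Without 1-cycles the copies of one atom form no cycles. -/
theorem IsAtomDense.disjoint_comp_atom (hB : IsAtomDense hc B) (h1 : HasNoOneCycles A)
    (x : DivAt A) (i j k : ℕ) : Disjoint (hB.atom (copyAt x i) ⨾ hB.atom (copyAt x j))
      (hB.atom (copyAt x k)) := by
  rw [disjoint_iff]
  refine Subtype.ext (ext fun r => ⟨?_, fun h => h.elim⟩)
  rintro ⟨hr, rfl⟩
  exact absurd ((SplitAtom.copy_mem_cycles_iff hc).1 (mem_single_comp.1 hr)).1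
    (not_divCycle_self h1 x)

/-- The atom-generated subalgebra has a nonzero element below the products of infinitely many
disjoint atoms with a fixed atom. -/
theorem IsAtomDense.exists_le_comp (hB : IsAtomDense hc B) {t : Fin 3 → κ}
    (ht : IsTrio (DivCycle (A := A)) c t) : ∃ x y z : DivAt A, ∀ i,
      hB.atom (copyAt z 0) ≤ hB.atom (copyAt x i) ⨾ hB.atom (copyAt y 0) := by
  obtain ⟨x, y, z, hx, hy, -, h⟩ := ht.pair 0 1 (t 0)
  refine ⟨x, y, z, fun i => ?_⟩
  rintro _ rfl
  refine mem_single_comp.2 ((SplitAtom.copy_mem_cycles_iff hc).2 ⟨h, fun h' => ?_⟩)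
  rw [hx, hy] at h'
  exact absurd (ht.injective h') (by decide)

theorem IsAtomDense.atom_ne_bot (hB : IsAtomDense hc B) (p : SplitAtom A) : hB.atom p ≠ ⊥ :=
  fun h => (isAtom_single p).1 (congrArg Subtype.val h)

theorem copyAt_ne {x : DivAt A} {i j : ℕ} (h : i ≠ j) : copyAt x i ≠ copyAt x j := by
  intro h'
  simp only [SplitAtom.copy.injEq] at h'
  exact h h'.2

variable [Finite A]

/-- In a complete representation every pair of distinct points of a class is related by a copy of a
diversity atom `x`; colour it with `x`. -/
theorem not_isCompletelyRepresentable (hB : IsAtomDense hc B) {t : Fin 3 → κ}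
    (ht : IsTrio (DivCycle (A := A)) c t) (h1 : HasNoOneCycles A) :
    ¬ IsCompletelyRepresentable.{u, w} B := by
  rintro ⟨U, ρ, hρ, hjoin⟩
  obtain ⟨x, y, z, hle⟩ := hB.exists_le_comp ht
  obtain ⟨w, hw, hwtop⟩ := hρ.exists_injective
    (fun i j h => hB.disjoint_atom (copyAt_ne (x := x) h)) (hB.atom_ne_bot _) hle
  have hlub : IsLUB (Set.range hB.atom) (⊤ : B) := by
    refine ⟨fun _ _ => le_top, fun b hb p _ => ?_⟩
    exact hb ⟨p, rfl⟩ (show p ∈ single E p from rfl)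
  have htop := hjoin _ _ hlub
  obtain ⟨k, a, b, d, ⟨i, hab⟩, ⟨j, hbd⟩, ⟨l, had⟩⟩ := exists_monochromatic_triangle w hw
    (fun (x : DivAt A) u v => ∃ i, (u, v) ∈ ρ (hB.atom (copyAt x i))) fun i j hij => by
      have h2 := hwtop i j
      rw [htop] at h2
      simp only [Set.mem_range, Set.iUnion_exists, Set.iUnion_iUnion_eq', Set.mem_iUnion] at h2
      obtain ⟨p, hp⟩ := h2
      cases p with
      | one =>
        have h3 : hB.atom (.one : SplitAtom A) = ide := rfl
        rw [h3, hρ.map_ide] at hp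
        exact absurd hp hij
      | copy x hx i => exact ⟨⟨x, hx⟩, i, hp⟩
  refine hρ.not_mem_of_disjoint (hB.disjoint_comp_atom h1 k i j l) ?_ had
  rw [hρ.map_comp]
  exact ⟨b, hab, hbd⟩

/-- In a completion the joins of the copies of the diversity atoms of `A`, one join for each atom,
colour the diversity pairs with finitely many colours. -/
theorem not_isRepresentable_of_isCompletionVia (hB : IsAtomDense hc B) {t : Fin 3 → κ}
    (ht : IsTrio (DivCycle (A := A)) c t) (h1 : HasNoOneCycles A) {D : Type*}
    [NonassocRelAlgebra D] {e : B → D} (he : IsCompletionVia e) :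
    ¬ IsRepresentable.{_, w} D := by
  rintro ⟨U, ρ, hρ⟩
  obtain ⟨he, hcomplete, hdense⟩ := he
  obtain ⟨x, y, z, hle⟩ := hB.exists_le_comp ht
  obtain ⟨w, hw, hwtop⟩ := hρ.exists_injective
    (fun i j h => he.disjoint (hB.disjoint_atom (copyAt_ne (x := x) h)))
    (fun h => hB.atom_ne_bot (copyAt z 0) (he.injective (h.trans he.map_bot.symm)))
    fun i => (he.mono (hle i)).trans (he.map_comp _ _).le
  choose X hX using fun x : DivAt A => hcomplete (Set.range fun i => e (hB.atom (copyAt x i)))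
  have := Fintype.ofFinite (DivAt A)
  have htop : (ide ⊔ Finset.univ.sup X)ᶜ = ⊥ := by
    by_contra hne
    obtain ⟨b, hb, hbd⟩ := hdense _ hne
    obtain ⟨p, hp⟩ := exists_mem_of_ne_bot (X := b.1) fun h => hb (Subtype.ext h)
    have hpb : hB.atom p ≤ b := by
      rintro _ rfl
      exact hp
    have h2 : e (hB.atom p) ≤ ide ⊔ Finset.univ.sup X := by
      cases p with
      | one =>
        have h3 : hB.atom (.one : SplitAtom A) = ide := rfl
        rw [h3, he.map_ide]
        exact le_sup_left
      | copy x hx i =>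
        exact ((hX ⟨x, hx⟩).1 ⟨i, rfl⟩).trans
          ((Finset.le_sup (Finset.mem_univ _)).trans le_sup_right)
    have h3 : e (hB.atom p) ≤ ⊥ :=
      (le_inf h2 ((he.mono hpb).trans hbd)).trans inf_compl_eq_bot.le
    exact hB.atom_ne_bot p (he.injective ((le_bot_iff.1 h3).trans he.map_bot.symm))
  obtain ⟨k, a, b, d, hab, hbd, had⟩ := exists_monochromatic_triangle w hw
    (fun (x : DivAt A) u v => (u, v) ∈ ρ (X x)) fun i j hij => by
      have h2 := hwtop i j
      rw [← compl_eq_bot.1 htop, hρ.map_sup, hρ.map_ide] at h2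
      exact hρ.exists_mem_of_mem_sup _ X (h2.resolve_left hij)
  have hdis : Disjoint (X k ⨾ X k) (X k) := by
    refine disjoint_comp_of_isLUB (hX k) ?_
    rintro _ ⟨i, rfl⟩ _ ⟨j, rfl⟩ _ ⟨l, rfl⟩
    dsimp only
    rw [← he.map_comp]
    exact he.disjoint (hB.disjoint_comp_atom h1 k i j l)
  refine hρ.not_mem_of_disjoint hdis ?_ had
  rw [hρ.map_comp]
  exact ⟨b, hab, hbd⟩

end SplitAlgebra

end RelAlg

open RelAlg
theorem theorem2 {A : Type u} [NonassocRelAlgebra A] [Finite A]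
    (hRA : IsRelationAlgebra A) (hsymm : IsSymmetric A) (hint : IsIntegralAlgebra A)
    (E : Subalg A) (hspec : IsSpecialExtension E)
    (htrio : ∃ a b c : E, IsFlexibleTrio a b c)
    (B : Subalg (SplitAlgebra E)) (hB : B = Subalg.atomGenerated (SplitAlgebra E)) :
    (∀ F : Subalg B, F.FG → ∃ G : Subalg B, (F : Set B) ⊆ G ∧ HasOnePointExtension G) ∧
    IsRepresentable.{u, v} B ∧
    IsCompletionVia (fun b : B => (b : SplitAlgebra E)) ∧
    (HasNoOneCycles A →
      ¬ IsCompletelyRepresentable.{u, v} B ∧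
      ¬ IsRepresentable.{u, v} (SplitAlgebra E) ∧
      ∀ (D : Type w) [NonassocRelAlgebra D] (e : B → D), IsCompletionVia e →
        ¬ IsRepresentable.{w, v} D) := by
  subst hB
  obtain ⟨t, ht⟩ := exists_isTrio_coverAtom hsymm hint htrio
  have hdense := SplitAlgebra.isAtomDense_atomGenerated (isThinningCover_coverAtom hsymm hspec)
  obtain ⟨t', ht'⟩ := hdense.exists_isTrio ht
  -- the limit cover is coarser than the cover by atoms of `E`, but its levels lie inside `B`
  have hdense' : SplitAlgebra.IsAtomDense hdense.isThinningCover
      (Subalg.atomGenerated (SplitAlgebra E)) :=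
    ⟨hdense.single_mem, fun X hX => hdense.exists_mem_level hX⟩
  have hcompl := SplitAlgebra.isCompletionVia hdense
  exact ⟨SplitAlgebra.exists_level_subalg hdense' (fun n X hX => hdense.level_le n hX) ht',
    SplitAlgebra.isRepresentable hdense.isThinningCover ht' _ hdense'.exists_level, hcompl,
    fun h1 => ⟨SplitAlgebra.not_isCompletelyRepresentable hdense ht h1,
      SplitAlgebra.not_isRepresentable_of_isCompletionVia hdense ht h1 hcompl,
      fun D _ e he => SplitAlgebra.not_isRepresentable_of_isCompletionVia hdense ht h1 he⟩⟩
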